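/- For $n\ge 1$ and $r\ge 1$ put $H_n^{(r)}=\sum_{k=1}^n k^{-r}$. For integers $p_1,\dots,p_m\ge 1$ and $q\ge 2$ let $$S_{p_1\cdots p_m,q}=\sum_{n=1}^\infty \frac{H_n^{(p_1)}\cdots H_n^{(p_m)}}{n^q}$$ (a linear Euler sum if $m=1$; $S_{1^2,q}$ means $S_{11,q}$), and for integers $s_1\ge 2$, $s_2,\dots,s_k\ge 1$ let $$\zeta(s_1,\dots,s_k)=\sum_{n_1>\cdots>n_k\ge 1}\frac{1}{n_1^{s_1}\cdots n_k^{s_k}} .$$ Give $\zeta(s)$ the weight $s$ and $S_{p,q}$ the weight $p+q$. A real number is said to reduce, in weight $w$, to given quantities if it is a polynomial in them with rational coefficients, all of whose monomials have weight $w$; "zeta values" are the numbers $\zeta(s)$, $s\ge 2$, and "linear sums" are the numbers $S_{p,q}$, $p\ge1$, $q\ge 2$. **Corollary (the Flajolet–Salvy theorem and the Borwein–Borwein–Girgensohn theorem, quadratic sums).** All series below converge, and the following hold. 1. For all integers $i_1,i_2\ge 1$ and $q\ge 2$, $$S_{i_1i_2,q}=\zeta(q,i_1+i_2)+\zeta(q,i_1,i_2)+\zeta(q,i_2,i_1)+\zeta(q+i_1+i_2)+\zeta(q+i_1,i_2)+\zeta(q+i_2,i_1).$$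 2. If $i_1,i_2>1$, $q\ge 2$ and the weight $w=i_1+i_2+q$ is even, then $S_{i_1i_2,q}$ reduces, in weight $w$, to linear sums and zeta values. 3. For every integer $q\ge 2$, $$S_{1^2,q}=S_{2,q}+\frac{(q+1)(q+3)}{3}\zeta(q+2)+\zeta(2)\zeta(q)-\frac{q+2}{2}\sum_{j=0}^{q-2}\zeta(j+2)\zeta(q-j)+\frac13\sum_{j=2}^{q-2}\zeta(q-j)\sum_{i=0}^{j-2}\zeta(i+2)\zeta(j-i),$$ where the sum over $2\le j\le q-2$ is empty for $q<4$. In particular $S_{1^2,q}-S_{2,q}$ reduces, in weight $q+2$, to zeta values. 4. For every odd integer $q\ge 3$, $S_{1^2,q}$ reduces, in weight $q+2$, to zeta values. -/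

import Mathlib

open scoped BigOperators

noncomputable section

/-- The generalized harmonic number `H_n^{(r)} = ∑_{k=1}^n 1 / k^r`. -/
def genHarmonic (n r : ℕ) : ℝ :=
  ∑ k ∈ Finset.Icc 1 n, 1 / (k : ℝ) ^ r

/-- The `n`-th term (for `n ≥ 1`) of the Euler sum of index `(p, q)`, that is
`H_n^{(p₁)} ⋯ H_n^{(pₘ)} / n^q` for `p = [p₁, …, pₘ]`. -/
def eulerTerm (p : List ℕ) (q n : ℕ) : ℝ :=
  (p.map fun r => genHarmonic n r).prod / (n : ℝ) ^ q

/-- The Euler sum `S_{p₁⋯pₘ,q} = ∑_{n ≥ 1} H_n^{(p₁)} ⋯ H_n^{(pₘ)} / n^q`. -/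
def eulerSum (p : List ℕ) (q : ℕ) : ℝ :=
  ∑' n : ℕ, eulerTerm p q (n + 1)

/-- Tuples `n₁ > n₂ > ⋯ > n_k ≥ 1` of natural numbers. -/
def DecTuple (k : ℕ) : Type :=
  {n : Fin k → ℕ // StrictAnti n ∧ ∀ i, 1 ≤ n i}

/-- The summand `1 / (n₁^{s₁} ⋯ n_k^{s_k})` of a multiple zeta value. -/
def mzvTerm (s : List ℕ) (n : DecTuple s.length) : ℝ :=
  ∏ i : Fin s.length, 1 / (n.1 i : ℝ) ^ s.get i

/-- The multiple zeta value
`ζ(s₁, …, s_k) = ∑_{n₁ > ⋯ > n_k ≥ 1} 1 / (n₁^{s₁} ⋯ n_k^{s_k})`. -/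
def mzv (s : List ℕ) : ℝ :=
  ∑' n : DecTuple s.length, mzvTerm s n

/-- The zeta value `ζ(s) = ∑_{k ≥ 1} 1 / k^s`, as a real number. -/
def zetaVal (s : ℕ) : ℝ :=
  ∑' k : ℕ, 1 / ((k : ℝ) + 1) ^ s

/-- `zetaVal` gives the values of the Riemann zeta function at the integers `s ≥ 2`. -/
theorem zetaVal_eq_riemannZeta {s : ℕ} (hs : 2 ≤ s) : (zetaVal s : ℂ) = riemannZeta s := by
  have h := zeta_eq_tsum_one_div_nat_add_one_cpow (s := (s : ℂ)) (by
    simp only [Complex.natCast_re]; exact_mod_cast hs)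
  rw [h, zetaVal, Complex.ofReal_tsum]
  refine tsum_congr fun k => ?_
  rw [Complex.cpow_natCast]
  push_cast
  rfl

/-- Multiple zeta values of depth one are zeta values. -/
theorem mzv_singleton (s : ℕ) : mzv [s] = zetaVal s := by
  let e : ℕ ≃ DecTuple [s].length :=
    { toFun := fun k => ⟨fun _ => k + 1, fun i j h => absurd h (by
        have hi : i = j := Subsingleton.elim (α := Fin 1) i j
        simp [hi]), fun _ => Nat.le_add_left 1 k⟩
      invFun := fun n => n.1 (0 : Fin 1) - 1
      left_inv := fun k => by simp
      right_inv := fun n => by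
        apply Subtype.ext
        funext i
        have hi : i = (0 : Fin 1) := Subsingleton.elim (α := Fin 1) i 0
        subst hi
        exact Nat.sub_add_cancel (n.2.2 _) }
  rw [mzv, zetaVal, ← e.tsum_eq]
  refine tsum_congr fun k => ?_
  change ∏ i : Fin 1, 1 / (((k + 1 : ℕ) : ℝ)) ^ ([s].get i) = _
  simp

/-- The indices `s ≥ 2` of the zeta values `ζ(s)`. -/
abbrev ZetaIndex : Type := {s : ℕ // 2 ≤ s}

/-- The indices `(p, q)`, `p ≥ 1`, `q ≥ 2`, of the linear Euler sums `S_{p,q}`. -/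
abbrev LinearIndex : Type := {a : ℕ × ℕ // 1 ≤ a.1 ∧ 2 ≤ a.2}

/-- `x` reduces to zeta values in weight `w`: it is the value of a polynomial with rational
coefficients in the zeta values `ζ(s)`, `s ≥ 2`, all of whose monomials have weight `w`, where
`ζ(s)` has weight `s`. -/
def ReducesToZeta (w : ℕ) (x : ℝ) : Prop :=
  ∃ P : MvPolynomial ZetaIndex ℚ,
    P.IsWeightedHomogeneous (fun s : ZetaIndex => s.1) w ∧
      x = MvPolynomial.aeval (fun s : ZetaIndex => zetaVal s.1) P

/-- `x` reduces to linear sums and zeta values in weight `w`: it is the value of a polynomial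
with rational coefficients in the zeta values `ζ(s)`, `s ≥ 2`, and the linear Euler sums
`S_{p,q}`, `p ≥ 1`, `q ≥ 2`, all of whose monomials have weight `w`, where `ζ(s)` has
weight `s` and `S_{p,q}` has weight `p + q`. -/
def ReducesToLinearAndZeta (w : ℕ) (x : ℝ) : Prop :=
  ∃ P : MvPolynomial (ZetaIndex ⊕ LinearIndex) ℚ,
    P.IsWeightedHomogeneous
        (Sum.elim (fun s : ZetaIndex => s.1) (fun a : LinearIndex => a.1.1 + a.1.2)) w ∧
      x = MvPolynomial.aeval
        (Sum.elim (fun s : ZetaIndex => zetaVal s.1)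
          (fun a : LinearIndex => eulerSum [a.1.1] a.1.2)) P

end

noncomputable section

open Filter Topology

/-! ### Reduction to given quantities -/

/-! Three independent mechanisms are at work.

Multiple zeta values: a product of two harmonic numbers is expanded by comparing the two summation
indices (`genHarmonic_mul_genHarmonic`), and the largest index `n` either strictly dominates the
others or coincides with some of them. This gives the six terms of the first identity.

The formula for `S_{1^2,q}`: `zetaSeries` is the expansion at `0` of `-(ψ(1 - X) + γ)`, a
regularised sum of the simple fractions `1 / (k - X)`. Its square and cube are computed twice: by
multiplying coefficients, which gives products of zeta values, and by partial fractions, where the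
residues are harmonic numbers, which gives Euler sums. To stay algebraic, partial fractions are done
for the truncation to `N` poles (`sum_simple_fractions_sq`, `sum_simple_fractions_cube`), and `N →
∞` is taken by dominated convergence. The square supplies `S_{1,q+1}`, which is then eliminated from
the cube.

Parity reductions: with the convention `0⁻¹ = 0`, let `T` be the absolutely convergent sum of `n⁻ᵠ
(n - k)⁻ᵖ (n - l)⁻ʳ` over integers `n` and `k, l ≥ 1`. Summing over `k, l` first gives products of
harmonic numbers for `n > 0`, and again for `n < 0` with the sign `(-1)^(q+p+r)`. In even weight the
two copies of `S_{pr,q}` add up, and all other terms are products of linear sums and zeta values.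
Summing over `n` first, partial fractions with poles `0, k, l` apply: the symmetric sum of `(n -
a)⁻ʲ` over the integers does not depend on `a` and is a multiple of `ζ(j)`. What remains are double
sums in `k, l`, that is, linear sums and zeta values. The same argument without `l`, in odd weight,
reduces linear sums to zeta values; for `S_{2,q}` with `q` odd this gives the last claim.

Both notions of reduction in the theorem are instances of `Reduces`, so these arguments are carried
out over any generators that account for the zeta values and, where needed, the linear sums. -/

/-- `x` is the value at `v` of a rational polynomial which is weighted homogeneous of weight `w`. -/
def Reduces {σ : Type*} (wt : σ → ℕ) (v : σ → ℝ) (w : ℕ) (x : ℝ) : Prop :=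
  ∃ P : MvPolynomial σ ℚ, P.IsWeightedHomogeneous wt w ∧ x = MvPolynomial.aeval v P

namespace Reduces

variable {σ : Type*} {wt : σ → ℕ} {v : σ → ℝ} {w w' : ℕ} {x y : ℝ}

theorem var (i : σ) : Reduces wt v (wt i) (v i) :=
  ⟨MvPolynomial.X i, MvPolynomial.isWeightedHomogeneous_X ℚ wt i, by simp⟩

theorem zero : Reduces wt v w 0 :=
  ⟨0, MvPolynomial.isWeightedHomogeneous_zero ℚ wt w, by simp⟩

theorem add (hx : Reduces wt v w x) (hy : Reduces wt v w y) : Reduces wt v w (x + y) := by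
  obtain ⟨P, hP, rfl⟩ := hx
  obtain ⟨Q, hQ, rfl⟩ := hy
  exact ⟨P + Q, hP.add hQ, by simp⟩

theorem mul (hx : Reduces wt v w x) (hy : Reduces wt v w' y) :
    Reduces wt v (w + w') (x * y) := by
  obtain ⟨P, hP, rfl⟩ := hx
  obtain ⟨Q, hQ, rfl⟩ := hy
  exact ⟨P * Q, hP.mul hQ, by simp⟩

theorem rat_mul (c : ℚ) (hx : Reduces wt v w x) : Reduces wt v w (c * x) := by
  obtain ⟨P, hP, rfl⟩ := hx
  exact ⟨MvPolynomial.C c * P, hP.C_mul c, by simp⟩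

theorem neg (hx : Reduces wt v w x) : Reduces wt v w (-x) := by
  simpa using rat_mul (-1) hx

theorem sub (hx : Reduces wt v w x) (hy : Reduces wt v w y) : Reduces wt v w (x - y) := by
  simpa [sub_eq_add_neg] using hx.add hy.neg

theorem neg_one_pow_mul (k : ℕ) (hx : Reduces wt v w x) : Reduces wt v w ((-1) ^ k * x) := by
  simpa using rat_mul ((-1) ^ k) hx

theorem sum {ι : Type*} {s : Finset ι} {f : ι → ℝ} (h : ∀ i ∈ s, Reduces wt v w (f i)) :
    Reduces wt v w (∑ i ∈ s, f i) := by
  classical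
  induction s using Finset.induction_on with
  | empty => simpa using zero
  | insert a s ha ih =>
    rw [Finset.sum_insert ha]
    exact (h a (by simp)).add (ih fun i hi => h i (by simp [hi]))

theorem congr_weight (hx : Reduces wt v w x) (h : w = w') : Reduces wt v w' x := h ▸ hx

end Reduces

/-! ### Bounds and summability for harmonic numbers -/

theorem genHarmonic_nonneg (n r : ℕ) : 0 ≤ genHarmonic n r :=
  Finset.sum_nonneg fun _ _ => by positivity

@[simp] theorem genHarmonic_zero (r : ℕ) : genHarmonic 0 r = 0 := by simp [genHarmonic]

theorem genHarmonic_succ (n r : ℕ) :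
    genHarmonic (n + 1) r = genHarmonic n r + ((n : ℝ) + 1)⁻¹ ^ r := by
  rw [genHarmonic, Finset.sum_Icc_succ_top (by omega)]
  simp [genHarmonic]

theorem genHarmonic_eq_sum_range (n r : ℕ) :
    genHarmonic n r = ∑ k ∈ Finset.range n, ((k : ℝ) + 1)⁻¹ ^ r := by
  induction n with
  | zero => simp
  | succ n ih => rw [genHarmonic_succ, Finset.sum_range_succ, ih]

theorem genHarmonic_mono {m n : ℕ} (h : m ≤ n) (r : ℕ) : genHarmonic m r ≤ genHarmonic n r :=
  Finset.sum_le_sum_of_subset_of_nonneg (Finset.Icc_subset_Icc_right h) fun _ _ _ => by positivity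

theorem genHarmonic_le_genHarmonic_one (n : ℕ) {r : ℕ} (hr : 1 ≤ r) :
    genHarmonic n r ≤ genHarmonic n 1 := by
  rw [genHarmonic_eq_sum_range, genHarmonic_eq_sum_range]
  refine Finset.sum_le_sum fun k _ => pow_le_pow_of_le_one (by positivity) ?_ hr
  exact inv_le_one_of_one_le₀ (by linarith [(Nat.cast_nonneg k : (0 : ℝ) ≤ k)])

/-- From `log x ≤ 4 x^(1/4)` and `1 ≤ x^(1/4)`. Any exponent below `1/2` would make the squared
bound summable against `n⁻²`. -/
theorem genHarmonic_one_le (n : ℕ) : genHarmonic (n + 1) 1 ≤ 5 * ((n : ℝ) + 1) ^ (1 / 4 : ℝ) := by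
  have h1 : genHarmonic (n + 1) 1 = (harmonic (n + 1) : ℝ) := by
    rw [genHarmonic_eq_sum_range, harmonic]
    simp
  have h2 := harmonic_le_one_add_log (n + 1)
  have h3 := Real.log_le_rpow_div (x := (n : ℝ) + 1) (by positivity) (ε := 1 / 4) (by norm_num)
  have h4 : (1 : ℝ) ≤ ((n : ℝ) + 1) ^ (1 / 4 : ℝ) :=
    Real.one_le_rpow (by linarith [(Nat.cast_nonneg n : (0 : ℝ) ≤ n)]) (by norm_num)
  rw [h1]
  push_cast at h2
  linarith

theorem summable_genHarmonic_sq :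
    Summable fun n : ℕ => genHarmonic (n + 1) 1 ^ 2 * ((n : ℝ) + 1)⁻¹ ^ 2 := by
  have hs : Summable fun n : ℕ => 25 * (1 / (((n + 1 : ℕ) : ℝ) ^ (3 / 2 : ℝ))) :=
    ((summable_nat_add_iff 1 (f := fun n : ℕ => 1 / ((n : ℝ) ^ (3 / 2 : ℝ)))).2
      (Real.summable_one_div_nat_rpow.2 (by norm_num))).mul_left 25
  refine Summable.of_nonneg_of_le (fun n => by positivity) (fun n => ?_) hs
  have hpos : (0 : ℝ) < (n : ℝ) + 1 := by positivity
  have h := pow_le_pow_left₀ (genHarmonic_nonneg _ _) (genHarmonic_one_le n) 2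
  calc genHarmonic (n + 1) 1 ^ 2 * ((n : ℝ) + 1)⁻¹ ^ 2
      ≤ (5 * ((n : ℝ) + 1) ^ (1 / 4 : ℝ)) ^ 2 * ((n : ℝ) + 1)⁻¹ ^ 2 := by gcongr
    _ = 25 * (1 / (((n + 1 : ℕ) : ℝ) ^ (3 / 2 : ℝ))) := by
      have e1 : (((n : ℝ) + 1) ^ (1 / 4 : ℝ)) ^ 2 = ((n : ℝ) + 1) ^ (1 / 2 : ℝ) := by
        rw [← Real.rpow_natCast, ← Real.rpow_mul hpos.le]; norm_num
      have e2 : ((n : ℝ) + 1) ^ 2 = ((n : ℝ) + 1) ^ (1 / 2 : ℝ) * ((n : ℝ) + 1) ^ (3 / 2 : ℝ) := by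
        rw [← Real.rpow_add hpos, ← Real.rpow_natCast]; norm_num
      rw [mul_pow, e1, inv_pow, e2]
      push_cast
      field_simp
      norm_num

theorem inv_succ_pow_le {q : ℕ} (hq : 2 ≤ q) (n : ℕ) :
    ((n : ℝ) + 1)⁻¹ ^ q ≤ ((n : ℝ) + 1)⁻¹ ^ 2 :=
  pow_le_pow_of_le_one (by positivity)
    (inv_le_one_of_one_le₀ (by linarith [(Nat.cast_nonneg n : (0 : ℝ) ≤ n)])) hq

theorem one_le_genHarmonic_one (n : ℕ) : 1 ≤ genHarmonic (n + 1) 1 := by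
  have h := genHarmonic_mono (show 1 ≤ n + 1 by omega) 1
  simpa [genHarmonic] using h

theorem summable_genHarmonic_mul_genHarmonic {a b q : ℕ} (ha : 1 ≤ a) (hb : 1 ≤ b) (hq : 2 ≤ q) :
    Summable fun n : ℕ =>
      genHarmonic (n + 1) a * genHarmonic (n + 1) b * ((n : ℝ) + 1)⁻¹ ^ q := by
  refine Summable.of_nonneg_of_le (fun n => ?_) (fun n => ?_) summable_genHarmonic_sq
  · have := genHarmonic_nonneg (n + 1) a
    have := genHarmonic_nonneg (n + 1) b
    positivity
  · have := genHarmonic_nonneg (n + 1) 1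
    have := genHarmonic_nonneg (n + 1) a
    have := genHarmonic_nonneg (n + 1) b
    rw [sq (genHarmonic _ _)]
    exact mul_le_mul (mul_le_mul (genHarmonic_le_genHarmonic_one _ ha)
      (genHarmonic_le_genHarmonic_one _ hb) ‹_› ‹_›) (inv_succ_pow_le hq n) (by positivity)
      (by positivity)

theorem summable_genHarmonic {a q : ℕ} (ha : 1 ≤ a) (hq : 2 ≤ q) :
    Summable fun n : ℕ => genHarmonic (n + 1) a * ((n : ℝ) + 1)⁻¹ ^ q := by
  refine Summable.of_nonneg_of_le (fun n => ?_) (fun n => ?_)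
    (summable_genHarmonic_mul_genHarmonic ha le_rfl hq)
  · have := genHarmonic_nonneg (n + 1) a
    positivity
  · have := genHarmonic_nonneg (n + 1) a
    have := one_le_genHarmonic_one n
    gcongr
    nlinarith

theorem summable_inv_succ_pow {q : ℕ} (hq : 2 ≤ q) : Summable fun n : ℕ => ((n : ℝ) + 1)⁻¹ ^ q := by
  have h := (summable_nat_add_iff 1 (f := fun n : ℕ => 1 / (n : ℝ) ^ q)).2
    (Real.summable_one_div_nat_pow.2 (by omega))
  simpa using h

theorem zetaVal_eq (s : ℕ) : zetaVal s = ∑' n : ℕ, ((n : ℝ) + 1)⁻¹ ^ s := by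
  simp [zetaVal]

theorem hasSum_zetaVal {s : ℕ} (hs : 2 ≤ s) :
    HasSum (fun n : ℕ => ((n : ℝ) + 1)⁻¹ ^ s) (zetaVal s) := by
  rw [zetaVal_eq]; exact (summable_inv_succ_pow hs).hasSum

theorem eulerTerm_single (p q n : ℕ) :
    eulerTerm [p] q (n + 1) = genHarmonic (n + 1) p * ((n : ℝ) + 1)⁻¹ ^ q := by
  simp [eulerTerm, div_eq_mul_inv]

theorem eulerTerm_pair (a b q n : ℕ) :
    eulerTerm [a, b] q (n + 1) =
      genHarmonic (n + 1) a * genHarmonic (n + 1) b * ((n : ℝ) + 1)⁻¹ ^ q := by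
  simp [eulerTerm, div_eq_mul_inv]

theorem hasSum_eulerSum_single {p q : ℕ} (hp : 1 ≤ p) (hq : 2 ≤ q) :
    HasSum (fun n : ℕ => genHarmonic (n + 1) p * ((n : ℝ) + 1)⁻¹ ^ q) (eulerSum [p] q) := by
  simp only [eulerSum, eulerTerm_single]
  exact (summable_genHarmonic hp hq).hasSum

theorem hasSum_eulerSum_pair {a b q : ℕ} (ha : 1 ≤ a) (hb : 1 ≤ b) (hq : 2 ≤ q) :
    HasSum (fun n : ℕ => genHarmonic (n + 1) a * genHarmonic (n + 1) b * ((n : ℝ) + 1)⁻¹ ^ q)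
      (eulerSum [a, b] q) := by
  simp only [eulerSum, eulerTerm_pair]
  exact (summable_genHarmonic_mul_genHarmonic ha hb hq).hasSum

/-! ### Multiple zeta values of depth two and three -/

/-- For nonnegative terms with finite fibres, summability needs checking only on the fibre sums.
Grouping tuples by their largest entry thus settles both convergence and value of a multiple zeta
value. -/
theorem summable_and_hasSum_sigma {β : ℕ → Type*} [∀ n, Fintype (β n)] {f : (Σ n, β n) → ℝ}
    (hf : ∀ x, 0 ≤ f x) {g : ℕ → ℝ} (hg : ∀ n, ∑ y, f ⟨n, y⟩ = g n) (hs : Summable g) :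
    Summable f ∧ HasSum g (∑' x, f x) := by
  have h1 : ∀ n, HasSum (fun y => f ⟨n, y⟩) (g n) := fun n => hg n ▸ hasSum_fintype _
  have h2 : Summable f := by
    rw [summable_sigma_of_nonneg hf]
    exact ⟨fun n => (h1 n).summable, by simpa only [(h1 _).tsum_eq] using hs⟩
  exact ⟨h2, h2.hasSum.sigma h1⟩

/-- Decreasing pairs, as a sigma type. -/
def decPairEquiv : (Σ n : ℕ, Fin n) ≃ DecTuple 2 where
  toFun x := ⟨![x.1 + 1, x.2 + 1], by
    have := x.2.2
    refine ⟨fun i j h => ?_, fun i => ?_⟩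
    · fin_cases i <;> fin_cases j <;> simp_all
    · fin_cases i <;> simp⟩
  invFun n := ⟨n.1 0 - 1, ⟨n.1 1 - 1, by
    have h1 : n.1 1 < n.1 0 := n.2.1 (by decide)
    have h2 := n.2.2 1
    omega⟩⟩
  left_inv x := by
    obtain ⟨n, i⟩ := x
    simp
  right_inv n := by
    apply Subtype.ext
    have h0 := n.2.2 0
    have h1 := n.2.2 1
    funext i
    fin_cases i <;> simp <;> omega

/-- Decreasing triples, as a sigma type. -/
def decTripleEquiv : (Σ n : ℕ, Σ i : Fin n, Fin i) ≃ DecTuple 3 where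
  toFun x := ⟨![x.1 + 1, x.2.1 + 1, x.2.2 + 1], by
    have h1 := x.2.1.2
    have h2 := x.2.2.2
    refine ⟨fun i j h => ?_, fun i => ?_⟩
    · fin_cases i <;> fin_cases j <;> simp_all
      omega
    · fin_cases i <;> simp⟩
  invFun n := ⟨n.1 0 - 1, ⟨n.1 1 - 1, by
    have h1 : n.1 1 < n.1 0 := n.2.1 (by decide)
    have h2 := n.2.2 1
    omega⟩, ⟨n.1 2 - 1, by
    have h1 : n.1 2 < n.1 1 := n.2.1 (by decide)
    have h2 := n.2.2 2
    simp only
    omega⟩⟩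
  left_inv x := by
    obtain ⟨n, i, j⟩ := x
    simp
  right_inv n := by
    apply Subtype.ext
    have h0 := n.2.2 0
    have h1 := n.2.2 1
    have h2 := n.2.2 2
    funext i
    fin_cases i <;> simp <;> omega

theorem mzvTerm_nonneg (s : List ℕ) (n : DecTuple s.length) : 0 ≤ mzvTerm s n :=
  Finset.prod_nonneg fun _ _ => by positivity

theorem mzvTerm_decPairEquiv (a b n : ℕ) (i : Fin n) :
    mzvTerm [a, b] (decPairEquiv ⟨n, i⟩) = ((n : ℝ) + 1)⁻¹ ^ a * ((i : ℝ) + 1)⁻¹ ^ b := by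
  change ∏ k : Fin 2, 1 / (((![n + 1, (i : ℕ) + 1] : Fin 2 → ℕ) k : ℕ) : ℝ) ^ [a, b].get k = _
  simp [Fin.prod_univ_two]
  ring

theorem mzvTerm_decTripleEquiv (a b c n : ℕ) (i : Fin n) (j : Fin i) :
    mzvTerm [a, b, c] (decTripleEquiv ⟨n, i, j⟩) =
      ((n : ℝ) + 1)⁻¹ ^ a * (((i : ℝ) + 1)⁻¹ ^ b * ((j : ℝ) + 1)⁻¹ ^ c) := by
  change ∏ k : Fin 3, 1 / (((![n + 1, (i : ℕ) + 1, (j : ℕ) + 1] : Fin 3 → ℕ) k : ℕ) : ℝ) ^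
    [a, b, c].get k = _
  simp [Fin.prod_univ_three]
  ring

theorem mzv_single_spec {a : ℕ} (ha : 2 ≤ a) :
    Summable (mzvTerm [a]) ∧ HasSum (fun n : ℕ => ((n : ℝ) + 1)⁻¹ ^ a) (mzv [a]) := by
  rw [mzv_singleton]
  refine ⟨?_, hasSum_zetaVal ha⟩
  -- A divergent `tsum` would be `0` by default, but this one equals a positive zeta value.
  by_contra h
  have h0 : mzv [a] = 0 := tsum_eq_zero_of_not_summable h
  have h1 := (hasSum_zetaVal ha).tsum_eq
  have h2 : 0 < ∑' n : ℕ, ((n : ℝ) + 1)⁻¹ ^ a :=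
    (summable_inv_succ_pow ha).tsum_pos (fun n => by positivity) 0 (by positivity)
  rw [mzv_singleton] at h0
  linarith

/-- The largest entry is `n + 1`, so the strict inequality leaves the inner sum `genHarmonic n b`,
without the term of index `n + 1`. -/
theorem mzv_pair_spec {a b : ℕ} (ha : 2 ≤ a) (hb : 1 ≤ b) :
    Summable (mzvTerm [a, b]) ∧
      HasSum (fun n : ℕ => ((n : ℝ) + 1)⁻¹ ^ a * genHarmonic n b) (mzv [a, b]) := by
  have hs : Summable fun n : ℕ => ((n : ℝ) + 1)⁻¹ ^ a * genHarmonic n b := by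
    refine Summable.of_nonneg_of_le (fun n => ?_) (fun n => ?_) (summable_genHarmonic hb ha)
    · have := genHarmonic_nonneg n b
      positivity
    · rw [mul_comm]
      have := genHarmonic_mono (Nat.le_succ n) b
      gcongr
  have h := summable_and_hasSum_sigma (β := fun n => Fin n)
    (f := fun x => mzvTerm [a, b] (decPairEquiv x)) (fun x => mzvTerm_nonneg _ _)
    (g := fun n : ℕ => ((n : ℝ) + 1)⁻¹ ^ a * genHarmonic n b) (fun n => by
      simp only [mzvTerm_decPairEquiv]
      rw [← Finset.mul_sum, genHarmonic_eq_sum_range,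
        Fin.sum_univ_eq_sum_range (fun k => ((k : ℝ) + 1)⁻¹ ^ b)]) hs
  refine ⟨decPairEquiv.summable_iff.1 h.1, ?_⟩
  have h2 := h.2
  rw [decPairEquiv.tsum_eq (mzvTerm [a, b])] at h2
  exact h2

theorem mzv_triple_spec {a b c : ℕ} (ha : 2 ≤ a) (hb : 1 ≤ b) (hc : 1 ≤ c) :
    Summable (mzvTerm [a, b, c]) ∧
      HasSum (fun n : ℕ => ((n : ℝ) + 1)⁻¹ ^ a *
        ∑ k ∈ Finset.range n, ((k : ℝ) + 1)⁻¹ ^ b * genHarmonic k c) (mzv [a, b, c]) := by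
  have hs : Summable fun n : ℕ => ((n : ℝ) + 1)⁻¹ ^ a *
      ∑ k ∈ Finset.range n, ((k : ℝ) + 1)⁻¹ ^ b * genHarmonic k c := by
    refine Summable.of_nonneg_of_le (fun n => ?_) (fun n => ?_)
      (summable_genHarmonic_mul_genHarmonic hb hc ha)
    · have : 0 ≤ ∑ k ∈ Finset.range n, ((k : ℝ) + 1)⁻¹ ^ b * genHarmonic k c :=
        Finset.sum_nonneg fun k _ => by
          have := genHarmonic_nonneg k c
          positivity
      positivity
    · rw [mul_comm]
      gcongr
      calc ∑ k ∈ Finset.range n, ((k : ℝ) + 1)⁻¹ ^ b * genHarmonic k c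
          ≤ ∑ k ∈ Finset.range n, ((k : ℝ) + 1)⁻¹ ^ b * genHarmonic (n + 1) c := by
            refine Finset.sum_le_sum fun k hk => ?_
            have := genHarmonic_mono (m := k) (n := n + 1)
              (by have := Finset.mem_range.1 hk; omega) c
            gcongr
        _ = genHarmonic n b * genHarmonic (n + 1) c := by
            rw [← Finset.sum_mul, genHarmonic_eq_sum_range n b]
        _ ≤ genHarmonic (n + 1) b * genHarmonic (n + 1) c := by
            have := genHarmonic_mono (Nat.le_succ n) b
            have := genHarmonic_nonneg (n + 1) c
            gcongr
  have h := summable_and_hasSum_sigma (β := fun n => Σ i : Fin n, Fin i)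
    (f := fun x => mzvTerm [a, b, c] (decTripleEquiv x)) (fun x => mzvTerm_nonneg _ _)
    (g := fun n : ℕ => ((n : ℝ) + 1)⁻¹ ^ a *
      ∑ k ∈ Finset.range n, ((k : ℝ) + 1)⁻¹ ^ b * genHarmonic k c) (fun n => by
      simp only [Fintype.sum_sigma, mzvTerm_decTripleEquiv]
      rw [← Fin.sum_univ_eq_sum_range (fun k => ((k : ℝ) + 1)⁻¹ ^ b * genHarmonic k c),
        Finset.mul_sum]
      refine Finset.sum_congr rfl fun i _ => ?_
      rw [← Finset.mul_sum, ← Finset.mul_sum, genHarmonic_eq_sum_range,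
        Fin.sum_univ_eq_sum_range (fun k => ((k : ℝ) + 1)⁻¹ ^ c)]) hs
  refine ⟨decTripleEquiv.summable_iff.1 h.1, ?_⟩
  have h2 := h.2
  rw [decTripleEquiv.tsum_eq (mzvTerm [a, b, c])] at h2
  exact h2

/-- Quasi-shuffle: the two indices are either ordered one way, ordered the other way, or equal. -/
theorem genHarmonic_mul_genHarmonic (a b n : ℕ) :
    genHarmonic n a * genHarmonic n b =
      ∑ k ∈ Finset.range n, ((k : ℝ) + 1)⁻¹ ^ a * genHarmonic k b +
      ∑ k ∈ Finset.range n, ((k : ℝ) + 1)⁻¹ ^ b * genHarmonic k a + genHarmonic n (a + b) := by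
  induction n with
  | zero => simp
  | succ n ih =>
    simp only [genHarmonic_succ, Finset.sum_range_succ, pow_add]
    linear_combination ih

theorem eulerSum_pair_eq_mzv {a b q : ℕ} (ha : 1 ≤ a) (hb : 1 ≤ b) (hq : 2 ≤ q) :
    eulerSum [a, b] q =
      mzv [q, a + b] + mzv [q, a, b] + mzv [q, b, a]
        + mzv [q + a + b] + mzv [q + a, b] + mzv [q + b, a] := by
  have h := (((((mzv_pair_spec (a := q) (b := a + b) hq (by omega)).2.add
    (mzv_triple_spec hq ha hb).2).add (mzv_triple_spec hq hb ha).2).add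
    (mzv_single_spec (a := q + a + b) (by omega)).2).add
    (mzv_pair_spec (a := q + a) (by omega) hb).2).add
    (mzv_pair_spec (a := q + b) (by omega) ha).2
  refine (hasSum_eulerSum_pair ha hb hq).unique ?_
  convert h using 2 with n
  have := genHarmonic_mul_genHarmonic a b n
  rw [genHarmonic_succ, genHarmonic_succ]
  simp only [pow_add] at this ⊢
  linear_combination ((n : ℝ) + 1)⁻¹ ^ q * this

/-! ### Powers of a sum of simple fractions -/

section SimpleFractions

variable {A ι : Type*} [CommRing A] [DecidableEq ι] {r : ι → ι → A} {Y : ι → A}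

/-- Think of `Y k` as `1 / (κ_k - X)` and of `r k l` as `1 / (κ_l - κ_k)`, with the convention `1 /
0 = 0`. The cross terms split by `hY`, and antisymmetry of `r` makes both halves agree. -/
theorem sum_simple_fractions_sq (hr : ∀ k l, r k l = -r l k) (hr0 : ∀ k, r k k = 0) (s : Finset ι)
    (hY : ∀ k ∈ s, ∀ l ∈ s, k ≠ l → Y k * Y l = r k l * (Y k - Y l)) :
    (∑ k ∈ s, Y k) ^ 2 = ∑ k ∈ s, Y k ^ 2 + 2 * ∑ k ∈ s, (∑ l ∈ s, r k l) * Y k := by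
  induction s using Finset.induction_on with
  | empty => simp
  | insert n s hn ih =>
    have ih' := ih fun k hk l hl => hY k (by simp [hk]) l (by simp [hl])
    have h1 : (∑ k ∈ s, Y k) * Y n = ∑ k ∈ s, r k n * Y k + (∑ k ∈ s, r n k) * Y n := by
      rw [Finset.sum_mul, Finset.sum_mul, ← Finset.sum_add_distrib]
      refine Finset.sum_congr rfl fun k hk => ?_
      rw [hY k (by simp [hk]) n (by simp) (fun h => hn (h ▸ hk)), hr n k]
      ring
    simp only [Finset.sum_insert hn, hr0, add_mul, Finset.sum_add_distrib]
    linear_combination ih' + 2 * h1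

/-- Near the pole `k` the sum is `Y + a + b Y⁻¹ + ⋯` with `a = ∑ r k l` and `b = -∑ (r k l)²`, so
its cube has polar part `Y³ + 3 a Y² + 3 (a² + b) Y`. The hypothesis `hrr` is the splitting rule for
the numbers `r n k` themselves. -/
theorem sum_simple_fractions_cube (hr : ∀ k l, r k l = -r l k) (hr0 : ∀ k, r k k = 0)
    (hrr : ∀ n k l, n ≠ k → n ≠ l → k ≠ l → r n k * r n l = r k l * (r n k - r n l))
    (s : Finset ι) (hY : ∀ k ∈ s, ∀ l ∈ s, k ≠ l → Y k * Y l = r k l * (Y k - Y l)) :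
    (∑ k ∈ s, Y k) ^ 3 = ∑ k ∈ s, Y k ^ 3 + 3 * ∑ k ∈ s, (∑ l ∈ s, r k l) * Y k ^ 2 +
      3 * ∑ k ∈ s, ((∑ l ∈ s, r k l) ^ 2 - ∑ l ∈ s, r k l ^ 2) * Y k := by
  induction s using Finset.induction_on with
  | empty => simp
  | insert n s hn ih =>
    have hne : ∀ k ∈ s, n ≠ k := fun k hk h => hn (h ▸ hk)
    have ih' := ih fun k hk l hl => hY k (by simp [hk]) l (by simp [hl])
    have hsq := sum_simple_fractions_sq hr hr0 s
      fun k hk l hl => hY k (by simp [hk]) l (by simp [hl])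
    -- Expands `(∑ r n k)²`, which enters the coefficient of the new `Y n`.
    have hsqr := sum_simple_fractions_sq (Y := fun k => r n k) hr hr0 s
      fun k hk l hl => hrr n k l (hne k hk) (hne l hl)
    have hYn : ∀ k ∈ s, Y k * Y n = r k n * (Y k - Y n) := fun k hk =>
      hY k (by simp [hk]) n (by simp) (hne k hk).symm
    have h1 : (∑ k ∈ s, Y k) * Y n ^ 2 = (∑ k ∈ s, r n k) * Y n ^ 2 -
        (∑ k ∈ s, r n k ^ 2) * Y n + ∑ k ∈ s, r k n ^ 2 * Y k := by
      rw [Finset.sum_mul, Finset.sum_mul, Finset.sum_mul, ← Finset.sum_sub_distrib,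
        ← Finset.sum_add_distrib]
      refine Finset.sum_congr rfl fun k hk => ?_
      rw [hr n k]
      linear_combination (Y n + r k n) * hYn k hk
    have h2 : (∑ k ∈ s, Y k ^ 2) * Y n = ∑ k ∈ s, r k n * Y k ^ 2 -
        ∑ k ∈ s, r k n ^ 2 * Y k + (∑ k ∈ s, r n k ^ 2) * Y n := by
      rw [Finset.sum_mul, Finset.sum_mul, ← Finset.sum_sub_distrib,
        ← Finset.sum_add_distrib]
      refine Finset.sum_congr rfl fun k hk => ?_
      rw [hr n k]
      linear_combination (Y k - r k n) * hYn k hk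
    have h3 : (∑ k ∈ s, (∑ l ∈ s, r k l) * Y k) * Y n =
        ∑ k ∈ s, (∑ l ∈ s, r k l) * r k n * Y k +
          (∑ k ∈ s, (∑ l ∈ s, r k l) * r n k) * Y n := by
      rw [Finset.sum_mul, Finset.sum_mul, ← Finset.sum_add_distrib]
      refine Finset.sum_congr rfl fun k hk => ?_
      rw [hr n k]
      linear_combination (∑ l ∈ s, r k l) * hYn k hk
    have h4 : ∑ k ∈ s, ((r k n + ∑ l ∈ s, r k l) ^ 2 - (r k n ^ 2 + ∑ l ∈ s, r k l ^ 2)) * Y k =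
        ∑ k ∈ s, ((∑ l ∈ s, r k l) ^ 2 - ∑ l ∈ s, r k l ^ 2) * Y k +
          2 * ∑ k ∈ s, (∑ l ∈ s, r k l) * r k n * Y k := by
      rw [Finset.mul_sum, ← Finset.sum_add_distrib]
      exact Finset.sum_congr rfl fun k hk => by ring
    simp only [Finset.sum_insert hn, hr0]
    rw [h4]
    simp only [add_mul, Finset.sum_add_distrib]
    linear_combination ih' + 3 * Y n * hsq + 3 * h1 + 3 * h2 + 6 * h3 - 3 * Y n * hsqr

end SimpleFractions

/-! ### The power series of `1 / (k + 1 - X)` -/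

/-- The power series of `1 / (k + 1 - X)`. -/
def simpleFraction (k : ℕ) : PowerSeries ℝ := PowerSeries.mk fun m => ((k : ℝ) + 1)⁻¹ ^ (m + 1)

theorem sub_X_mul_eq {κ : ℝ} {f g : ℕ → ℝ} (h0 : κ * f 0 = g 0)
    (h : ∀ m, κ * f (m + 1) - f m = g (m + 1)) :
    (PowerSeries.C κ - PowerSeries.X) * PowerSeries.mk f = PowerSeries.mk g := by
  ext m
  cases m with
  | zero => simp [sub_mul, h0]
  | succ m => simp [sub_mul, PowerSeries.coeff_succ_X_mul, h]

theorem sub_X_mul_simpleFraction (k : ℕ) :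
    (PowerSeries.C ((k : ℝ) + 1) - PowerSeries.X) * simpleFraction k = 1 := by
  have hk : (k : ℝ) + 1 ≠ 0 := by positivity
  have h1 : (1 : PowerSeries ℝ) = PowerSeries.mk fun m => if m = 0 then 1 else 0 := by
    ext m; simp [PowerSeries.coeff_one]
  rw [h1]
  refine sub_X_mul_eq ?_ fun m => ?_
  · simp [hk]
  · simp only [pow_succ]
    field_simp
    simp

/-- The candidate series times `k + 1 - X` is `simpleFraction k`, and `k + 1 - X` is invertible. -/
theorem simpleFraction_sq (k : ℕ) : simpleFraction k ^ 2 =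
    PowerSeries.mk fun m => ((m : ℝ) + 1) * ((k : ℝ) + 1)⁻¹ ^ (m + 2) := by
  have hk : (k : ℝ) + 1 ≠ 0 := by positivity
  have h : (PowerSeries.C ((k : ℝ) + 1) - PowerSeries.X) *
      (PowerSeries.mk fun m : ℕ => ((m : ℝ) + 1) * ((k : ℝ) + 1)⁻¹ ^ (m + 2)) =
      simpleFraction k := by
    refine sub_X_mul_eq ?_ fun m => ?_
    · simp; field_simp
    · push_cast
      simp only [pow_succ]
      field_simp
      ring
  have h1 := sub_X_mul_simpleFraction k
  linear_combination (-simpleFraction k) * h + (PowerSeries.mk fun m : ℕ =>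
    ((m : ℝ) + 1) * ((k : ℝ) + 1)⁻¹ ^ (m + 2)) * h1

theorem simpleFraction_cube (k : ℕ) : simpleFraction k ^ 3 =
    PowerSeries.mk fun m => ((m : ℝ) + 1) * (m + 2) / 2 * ((k : ℝ) + 1)⁻¹ ^ (m + 3) := by
  have hk : (k : ℝ) + 1 ≠ 0 := by positivity
  have h : (PowerSeries.C ((k : ℝ) + 1) - PowerSeries.X) *
      (PowerSeries.mk fun m : ℕ => ((m : ℝ) + 1) * (m + 2) / 2 * ((k : ℝ) + 1)⁻¹ ^ (m + 3)) =
      simpleFraction k ^ 2 := by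
    rw [simpleFraction_sq]
    refine sub_X_mul_eq ?_ fun m => ?_
    · simp; field_simp
    · push_cast
      simp only [pow_succ]
      field_simp
      ring
  have h1 := sub_X_mul_simpleFraction k
  linear_combination (-simpleFraction k) * h + (PowerSeries.mk fun m : ℕ =>
    ((m : ℝ) + 1) * (m + 2) / 2 * ((k : ℝ) + 1)⁻¹ ^ (m + 3)) * h1

theorem simpleFraction_mul (k l : ℕ) (h : k ≠ l) : simpleFraction k * simpleFraction l =
    PowerSeries.C (((l : ℝ) - k)⁻¹) * (simpleFraction k - simpleFraction l) := by
  have hkl : (l : ℝ) - k ≠ 0 := sub_ne_zero.2 (by exact_mod_cast h.symm)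
  have h1 := sub_X_mul_simpleFraction k
  have h2 := sub_X_mul_simpleFraction l
  have h3 : PowerSeries.C (((l : ℝ) - k)⁻¹) *
      (PowerSeries.C ((l : ℝ) + 1) - PowerSeries.C ((k : ℝ) + 1)) = 1 := by
    rw [← map_sub, ← map_mul]
    have : ((l : ℝ) - k)⁻¹ * ((l : ℝ) + 1 - (k + 1)) = 1 := by
      field_simp; ring
    rw [this, map_one]
  linear_combination (-simpleFraction k * simpleFraction l) * h3 +
    PowerSeries.C (((l : ℝ) - k)⁻¹) * (simpleFraction k * h2 - simpleFraction l * h1)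

/-- The sum of `1 / (l - k)` over `l < N`, `l ≠ k`. -/
def diffSum (p N k : ℕ) : ℝ := ∑ l ∈ Finset.range N, ((l : ℝ) - k)⁻¹ ^ p

/-- The power series `∑_{m ≥ 1} H_N^{(m+1)} X^m`. -/
def harmonicSeries (N : ℕ) : PowerSeries ℝ :=
  PowerSeries.mk fun m => if m = 0 then 0 else genHarmonic N (m + 1)

theorem harmonicSeries_eq (N : ℕ) : harmonicSeries N =
    ∑ k ∈ Finset.range N, simpleFraction k - PowerSeries.C (genHarmonic N 1) := by
  ext m
  cases m with
  | zero => simp [harmonicSeries, simpleFraction, genHarmonic_eq_sum_range]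
  | succ m =>
    simp [harmonicSeries, simpleFraction, genHarmonic_eq_sum_range]

/-- Subtracting the constant `H_N` shifts the residue `diffSum 1 N k` to `diffSum 1 N k - H_N`,
which converges as `N → ∞` although each part diverges. The constant term drops out because `m ≥ 1`.
-/
theorem coeff_harmonicSeries_sq (N : ℕ) {m : ℕ} (hm : 1 ≤ m) :
    PowerSeries.coeff m (harmonicSeries N ^ 2) =
      ∑ k ∈ Finset.range N, ((m : ℝ) + 1) * ((k : ℝ) + 1)⁻¹ ^ (m + 2) -
      2 * ∑ k ∈ Finset.range N, (genHarmonic N 1 - diffSum 1 N k) *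
        ((k : ℝ) + 1)⁻¹ ^ (m + 1) := by
  have h := sum_simple_fractions_sq (A := PowerSeries ℝ)
    (r := fun k l : ℕ => PowerSeries.C (((l : ℝ) - k)⁻¹)) (Y := simpleFraction)
    (fun k l => by rw [← map_neg, ← inv_neg, neg_sub]) (fun k => by simp) (Finset.range N)
    (fun k _ l _ hkl => simpleFraction_mul k l hkl)
  have h1 : harmonicSeries N ^ 2 = ∑ k ∈ Finset.range N, simpleFraction k ^ 2 -
      PowerSeries.C 2 * ∑ k ∈ Finset.range N,
        PowerSeries.C (genHarmonic N 1 - diffSum 1 N k) * simpleFraction k +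
      PowerSeries.C (genHarmonic N 1 ^ 2) := by
    have h2 : (2 : PowerSeries ℝ) = PowerSeries.C 2 := (map_ofNat PowerSeries.C 2).symm
    rw [harmonicSeries_eq]
    simp only [map_sub, sub_mul, Finset.sum_sub_distrib, ← Finset.mul_sum, map_pow, diffSum,
      map_sum, pow_one]
    rw [← h2]
    linear_combination h
  rw [h1]
  simp only [simpleFraction_sq, LinearMap.map_add, LinearMap.map_sub, map_sum,
    PowerSeries.coeff_C_mul]
  simp only [PowerSeries.coeff_mk, simpleFraction, PowerSeries.coeff_C,
    if_neg (show m ≠ 0 by omega), add_zero]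

theorem coeff_harmonicSeries_cube (N : ℕ) {m : ℕ} (hm : 1 ≤ m) :
    PowerSeries.coeff m (harmonicSeries N ^ 3) =
      ∑ k ∈ Finset.range N, ((m : ℝ) + 1) * (m + 2) / 2 * ((k : ℝ) + 1)⁻¹ ^ (m + 3) -
      3 * ∑ k ∈ Finset.range N, (genHarmonic N 1 - diffSum 1 N k) *
        (((m : ℝ) + 1) * ((k : ℝ) + 1)⁻¹ ^ (m + 2)) +
      3 * ∑ k ∈ Finset.range N, ((genHarmonic N 1 - diffSum 1 N k) ^ 2 - diffSum 2 N k) *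
        ((k : ℝ) + 1)⁻¹ ^ (m + 1) := by
  have hr : ∀ k l : ℕ, PowerSeries.C (((l : ℝ) - k)⁻¹) = -PowerSeries.C (((k : ℝ) - l)⁻¹) :=
    fun k l => by rw [← map_neg, ← inv_neg, neg_sub]
  have hY : ∀ k ∈ Finset.range N, ∀ l ∈ Finset.range N, k ≠ l → _ :=
    fun k _ l _ hkl => simpleFraction_mul k l hkl
  have h := sum_simple_fractions_sq (A := PowerSeries ℝ)
    (r := fun k l : ℕ => PowerSeries.C (((l : ℝ) - k)⁻¹)) (Y := simpleFraction)
    hr (fun k => by simp) (Finset.range N) hY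
  have h' := sum_simple_fractions_cube (A := PowerSeries ℝ)
    (r := fun k l : ℕ => PowerSeries.C (((l : ℝ) - k)⁻¹)) (Y := simpleFraction)
    hr (fun k => by simp) (fun n k l hnk hnl hkl => by
      rw [← map_mul, ← map_sub, ← map_mul]
      congr 1
      have h1 : (k : ℝ) - n ≠ 0 := sub_ne_zero.2 (by exact_mod_cast hnk.symm)
      have h2 : (l : ℝ) - n ≠ 0 := sub_ne_zero.2 (by exact_mod_cast hnl.symm)
      have h3 : (l : ℝ) - k ≠ 0 := sub_ne_zero.2 (by exact_mod_cast hkl.symm)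
      field_simp
      ring) (Finset.range N) hY
  have h1 : harmonicSeries N ^ 3 = ∑ k ∈ Finset.range N, simpleFraction k ^ 3 -
      PowerSeries.C 3 * ∑ k ∈ Finset.range N,
        PowerSeries.C (genHarmonic N 1 - diffSum 1 N k) * simpleFraction k ^ 2 +
      PowerSeries.C 3 * ∑ k ∈ Finset.range N,
        PowerSeries.C ((genHarmonic N 1 - diffSum 1 N k) ^ 2 - diffSum 2 N k) * simpleFraction k -
      PowerSeries.C (genHarmonic N 1 ^ 3) := by
    have h2 : (3 : PowerSeries ℝ) = PowerSeries.C 3 := (map_ofNat PowerSeries.C 3).symm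
    have h3 : ∀ k, PowerSeries.C ((genHarmonic N 1 - diffSum 1 N k) ^ 2 - diffSum 2 N k) *
        simpleFraction k = PowerSeries.C (genHarmonic N 1) ^ 2 * simpleFraction k -
          2 * PowerSeries.C (genHarmonic N 1) * (PowerSeries.C (diffSum 1 N k) *
            simpleFraction k) +
          (PowerSeries.C (diffSum 1 N k) ^ 2 - PowerSeries.C (diffSum 2 N k)) *
            simpleFraction k := fun k => by
      simp only [map_sub, map_pow]
      ring
    rw [harmonicSeries_eq]
    simp only [h3]
    simp only [map_sub, sub_mul, Finset.sum_sub_distrib, Finset.sum_add_distrib,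
      ← Finset.mul_sum, map_pow, diffSum, map_sum, pow_one] at h' ⊢
    rw [← h2]
    -- Binomial expansion of `(∑ Y - H_N)³`.
    linear_combination h' - 3 * PowerSeries.C (genHarmonic N 1) * h
  rw [h1]
  simp only [simpleFraction_sq, simpleFraction_cube, LinearMap.map_add, LinearMap.map_sub, map_sum,
    PowerSeries.coeff_C_mul]
  simp only [PowerSeries.coeff_mk, simpleFraction, PowerSeries.coeff_C,
    if_neg (show m ≠ 0 by omega), sub_zero]

/-! ### Passage to the limit -/

/-- The indices above `k` give `genHarmonic M p`, those below give the signed `genHarmonic k p`, and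
`l = k` contributes `0⁻¹ ^ p = 0`. -/
theorem diffSum_eq {p : ℕ} (hp : 1 ≤ p) (k M : ℕ) :
    diffSum p (k + (M + 1)) k = genHarmonic M p + (-1) ^ p * genHarmonic k p := by
  rw [diffSum, Finset.sum_range_add, add_comm, Finset.sum_range_succ']
  congr 1
  · rw [genHarmonic_eq_sum_range]
    simp [show p ≠ 0 by omega]
  · rw [genHarmonic_eq_sum_range, ← Finset.sum_range_reflect, Finset.mul_sum]
    refine Finset.sum_congr rfl fun j hj => ?_
    have hj' := Finset.mem_range.1 hj
    rw [← mul_pow, neg_one_mul, ← inv_neg]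
    congr 2
    have : ((k - 1 - j : ℕ) : ℝ) = (k : ℝ) - 1 - j := by
      rw [Nat.cast_sub (by omega), Nat.cast_sub (by omega)]; simp
    rw [this]
    ring

/-- Tannery's theorem, with the bound required only inside the range of summation. -/
theorem tendsto_sum_range_of_dominated {f : ℕ → ℕ → ℝ} {g bound : ℕ → ℝ} (hb : Summable bound)
    (hf : ∀ k, Tendsto (fun N => f N k) atTop (𝓝 (g k)))
    (hle : ∀ N k, k < N → |f N k| ≤ bound k) :
    Tendsto (fun N => ∑ k ∈ Finset.range N, f N k) atTop (𝓝 (∑' k, g k)) := by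
  have hb0 : ∀ k, 0 ≤ bound k := fun k => (abs_nonneg _).trans (hle (k + 1) k (Nat.lt_succ_self k))
  have h := tendsto_tsum_of_dominated_convergence (𝓕 := atTop)
    (f := fun N k => if k < N then f N k else 0) (g := g) hb (fun k => (hf k).congr' ?_)
    (Eventually.of_forall fun N k => ?_)
  · refine h.congr fun N => ?_
    rw [tsum_eq_sum (s := Finset.range N) fun k hk => if_neg (by simpa using hk)]
    exact Finset.sum_congr rfl fun k hk => if_pos (Finset.mem_range.1 hk)
  · filter_upwards [eventually_gt_atTop k] with N hN
    rw [if_pos hN]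
  · split_ifs with hk
    · exact hle N k hk
    · simpa using hb0 k

theorem tendsto_genHarmonic {p : ℕ} (hp : 2 ≤ p) :
    Tendsto (fun N => genHarmonic N p) atTop (𝓝 (zetaVal p)) := by
  simp only [genHarmonic_eq_sum_range]
  exact (hasSum_zetaVal hp).tendsto_sum_nat

theorem genHarmonic_le_zetaVal {p : ℕ} (hp : 2 ≤ p) (n : ℕ) : genHarmonic n p ≤ zetaVal p := by
  rw [genHarmonic_eq_sum_range, zetaVal_eq]
  exact (summable_inv_succ_pow hp).sum_le_tsum _ fun _ _ => by positivity

theorem genHarmonic_one_add_le (a b : ℕ) :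
    genHarmonic (a + b) 1 ≤ genHarmonic a 1 + genHarmonic b 1 := by
  induction b with
  | zero => simp
  | succ b ih =>
    rw [← add_assoc, genHarmonic_succ, genHarmonic_succ b]
    have : (((a + b : ℕ) : ℝ) + 1)⁻¹ ≤ ((b : ℝ) + 1)⁻¹ := by
      gcongr
      omega
    simp only [pow_one]
    linarith

theorem tendsto_genHarmonic_one_add_sub (b : ℕ) :
    Tendsto (fun a => genHarmonic (a + b) 1 - genHarmonic a 1) atTop (𝓝 0) := by
  induction b with
  | zero => simp
  | succ b ih =>
    have h : Tendsto (fun a : ℕ => (((a + b : ℕ) : ℝ) + 1)⁻¹) atTop (𝓝 0) :=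
      tendsto_inv_atTop_zero.comp (tendsto_atTop_add_const_right _ _
        (tendsto_natCast_atTop_atTop.comp (tendsto_add_atTop_nat b)))
    have h2 := ih.add h
    rw [add_zero] at h2
    refine h2.congr fun a => ?_
    rw [← add_assoc, genHarmonic_succ]
    ring

theorem tendsto_genHarmonic_sub_diffSum (k : ℕ) :
    Tendsto (fun N => genHarmonic N 1 - diffSum 1 N k) atTop (𝓝 (genHarmonic k 1)) := by
  rw [← tendsto_add_atTop_iff_nat (k + 1)]
  have h := (tendsto_genHarmonic_one_add_sub (k + 1)).add_const (genHarmonic k 1)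
  rw [zero_add] at h
  refine h.congr fun M => ?_
  rw [show diffSum 1 (M + (k + 1)) k = diffSum 1 (k + (M + 1)) k by congr 1; omega,
    diffSum_eq le_rfl]
  ring

theorem abs_genHarmonic_sub_diffSum_le {N k : ℕ} (h : k < N) :
    |genHarmonic N 1 - diffSum 1 N k| ≤ 2 * genHarmonic (k + 1) 1 := by
  obtain ⟨M, rfl⟩ : ∃ M, N = k + (M + 1) := ⟨N - k - 1, by omega⟩
  rw [diffSum_eq le_rfl]
  have h1 := genHarmonic_one_add_le M (k + 1)
  rw [show M + (k + 1) = k + (M + 1) by omega] at h1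
  have h2 := genHarmonic_mono (show M ≤ k + (M + 1) by omega) 1
  have h3 := genHarmonic_mono (Nat.le_succ k) 1
  have h4 := genHarmonic_nonneg k 1
  rw [abs_le]
  constructor <;> linarith

theorem tendsto_diffSum_two (k : ℕ) :
    Tendsto (fun N => diffSum 2 N k) atTop (𝓝 (zetaVal 2 + genHarmonic k 2)) := by
  rw [← tendsto_add_atTop_iff_nat (k + 1)]
  refine ((tendsto_genHarmonic le_rfl).add_const (genHarmonic k 2)).congr fun M => ?_
  rw [show diffSum 2 (M + (k + 1)) k = diffSum 2 (k + (M + 1)) k by congr 1; omega,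
    diffSum_eq (by norm_num)]
  ring

theorem abs_diffSum_two_le {N k : ℕ} (h : k < N) : |diffSum 2 N k| ≤ 2 * zetaVal 2 := by
  obtain ⟨M, rfl⟩ : ∃ M, N = k + (M + 1) := ⟨N - k - 1, by omega⟩
  rw [diffSum_eq (by norm_num)]
  have h1 := genHarmonic_le_zetaVal le_rfl M
  have h2 := genHarmonic_le_zetaVal le_rfl k
  have h3 := genHarmonic_nonneg M 2
  have h4 := genHarmonic_nonneg k 2
  rw [abs_le]
  constructor <;> linarith

/-- The power series `∑_{m ≥ 1} ζ(m + 1) X^m`. -/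
def zetaSeries : PowerSeries ℝ := PowerSeries.mk fun m => if m = 0 then 0 else zetaVal (m + 1)

theorem tendsto_coeff_mul {F G : ℕ → PowerSeries ℝ} {f g : PowerSeries ℝ}
    (hF : ∀ m, Tendsto (fun N => PowerSeries.coeff m (F N)) atTop (𝓝 (PowerSeries.coeff m f)))
    (hG : ∀ m, Tendsto (fun N => PowerSeries.coeff m (G N)) atTop (𝓝 (PowerSeries.coeff m g)))
    (m : ℕ) :
    Tendsto (fun N => PowerSeries.coeff m (F N * G N)) atTop (𝓝 (PowerSeries.coeff m (f * g))) := by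
  simp only [PowerSeries.coeff_mul]
  exact tendsto_finsetSum _ fun i _ => (hF i.1).mul (hG i.2)

theorem tendsto_coeff_harmonicSeries (m : ℕ) :
    Tendsto (fun N => PowerSeries.coeff m (harmonicSeries N)) atTop
      (𝓝 (PowerSeries.coeff m zetaSeries)) := by
  simp only [harmonicSeries, zetaSeries, PowerSeries.coeff_mk]
  split_ifs with h
  · exact tendsto_const_nhds
  · exact tendsto_genHarmonic (by omega)

theorem tendsto_sum_range_inv_pow {q : ℕ} (hq : 2 ≤ q) :
    Tendsto (fun N => ∑ k ∈ Finset.range N, ((k : ℝ) + 1)⁻¹ ^ q) atTop (𝓝 (zetaVal q)) :=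
  (hasSum_zetaVal hq).tendsto_sum_nat

theorem tendsto_sum_genHarmonic_sub_diffSum {q : ℕ} (hq : 2 ≤ q) :
    Tendsto (fun N => ∑ k ∈ Finset.range N,
      (genHarmonic N 1 - diffSum 1 N k) * ((k : ℝ) + 1)⁻¹ ^ q) atTop
      (𝓝 (∑' k : ℕ, genHarmonic k 1 * ((k : ℝ) + 1)⁻¹ ^ q)) := by
  refine tendsto_sum_range_of_dominated ((summable_genHarmonic le_rfl hq).mul_left 2)
    (fun k => (tendsto_genHarmonic_sub_diffSum k).mul_const _) fun N k hk => ?_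
  rw [abs_mul, abs_of_nonneg (a := ((k : ℝ) + 1)⁻¹ ^ q) (by positivity), ← mul_assoc]
  exact mul_le_mul_of_nonneg_right (abs_genHarmonic_sub_diffSum_le hk) (by positivity)

theorem tendsto_sum_genHarmonic_sub_diffSum_sq {q : ℕ} (hq : 2 ≤ q) :
    Tendsto (fun N => ∑ k ∈ Finset.range N,
      ((genHarmonic N 1 - diffSum 1 N k) ^ 2 - diffSum 2 N k) * ((k : ℝ) + 1)⁻¹ ^ q) atTop
      (𝓝 (∑' k : ℕ, (genHarmonic k 1 ^ 2 - (zetaVal 2 + genHarmonic k 2)) *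
        ((k : ℝ) + 1)⁻¹ ^ q)) := by
  refine tendsto_sum_range_of_dominated
    (((summable_genHarmonic_mul_genHarmonic le_rfl le_rfl hq).mul_left 4).add
      ((summable_inv_succ_pow hq).mul_left (2 * zetaVal 2)))
    (fun k => (((tendsto_genHarmonic_sub_diffSum k).pow 2).sub (tendsto_diffSum_two k)).mul_const _)
    fun N k hk => ?_
  rw [abs_mul, abs_of_nonneg (a := ((k : ℝ) + 1)⁻¹ ^ q) (by positivity), ← mul_assoc, ← add_mul]
  refine mul_le_mul_of_nonneg_right ?_ (by positivity)
  have h1 := abs_genHarmonic_sub_diffSum_le hk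
  have h2 := abs_diffSum_two_le hk
  have h3 : (genHarmonic N 1 - diffSum 1 N k) ^ 2 ≤ (2 * genHarmonic (k + 1) 1) ^ 2 := by
    rw [← sq_abs]
    exact pow_le_pow_left₀ (abs_nonneg _) h1 2
  refine (abs_sub _ _).trans ?_
  rw [abs_of_nonneg (a := (genHarmonic N 1 - diffSum 1 N k) ^ 2) (sq_nonneg _)]
  linarith

/-! ### Coefficients of the square and the cube of the zeta series -/

theorem coeff_zetaSeries_sq {m : ℕ} (hm : 1 ≤ m) :
    PowerSeries.coeff m (zetaSeries ^ 2) = ((m : ℝ) + 1) * zetaVal (m + 2) -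
      2 * ∑' k : ℕ, genHarmonic k 1 * ((k : ℝ) + 1)⁻¹ ^ (m + 1) := by
  have h1 := tendsto_coeff_mul tendsto_coeff_harmonicSeries tendsto_coeff_harmonicSeries m
  simp only [← sq, coeff_harmonicSeries_sq _ hm, ← Finset.mul_sum] at h1
  exact tendsto_nhds_unique h1 (((tendsto_sum_range_inv_pow (by omega)).const_mul _).sub
    ((tendsto_sum_genHarmonic_sub_diffSum (by omega)).const_mul _))

theorem coeff_zetaSeries_cube {m : ℕ} (hm : 1 ≤ m) :
    PowerSeries.coeff m (zetaSeries ^ 3) = ((m : ℝ) + 1) * (m + 2) / 2 * zetaVal (m + 3) -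
      3 * (((m : ℝ) + 1) * ∑' k : ℕ, genHarmonic k 1 * ((k : ℝ) + 1)⁻¹ ^ (m + 2)) +
      3 * ∑' k : ℕ, (genHarmonic k 1 ^ 2 - (zetaVal 2 + genHarmonic k 2)) *
        ((k : ℝ) + 1)⁻¹ ^ (m + 1) := by
  have h1 := tendsto_coeff_mul (tendsto_coeff_mul tendsto_coeff_harmonicSeries
    tendsto_coeff_harmonicSeries) tendsto_coeff_harmonicSeries m
  simp only [← sq, ← pow_succ, Nat.reduceAdd, coeff_harmonicSeries_cube _ hm, mul_left_comm _
    ((m : ℝ) + 1), ← Finset.mul_sum] at h1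
  have h2 := (tendsto_sum_range_inv_pow (q := m + 3) (by omega)).const_mul
    (((m : ℝ) + 1) * (m + 2) / 2)
  have h3 := ((tendsto_sum_genHarmonic_sub_diffSum (q := m + 2) (by omega)).const_mul
    ((m : ℝ) + 1)).const_mul 3
  have h4 := (tendsto_sum_genHarmonic_sub_diffSum_sq (q := m + 1) (by omega)).const_mul 3
  exact tendsto_nhds_unique h1 (((h2.sub h3).add h4).congr fun N => by ring)

theorem coeff_zetaSeries_sq_eq_sum {q : ℕ} (hq : 2 ≤ q) : PowerSeries.coeff q (zetaSeries ^ 2) =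
    ∑ j ∈ Finset.Icc 0 (q - 2), zetaVal (j + 2) * zetaVal (q - j) := by
  obtain ⟨t, rfl⟩ : ∃ t, q = t + 2 := ⟨q - 2, by omega⟩
  have h : zetaSeries = PowerSeries.X * PowerSeries.mk fun m => zetaVal (m + 2) := by
    ext m
    cases m <;> simp [zetaSeries, PowerSeries.coeff_succ_X_mul]
  rw [h, mul_pow, add_comm, PowerSeries.coeff_X_pow_mul', if_pos (by omega), Nat.add_sub_cancel_left,
    sq, PowerSeries.coeff_mul, Finset.Nat.sum_antidiagonal_eq_sum_range_succ_mk]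
  refine Finset.sum_congr (by ext; simp) fun j hj => ?_
  simp only [Finset.mem_Icc] at hj
  simp only [PowerSeries.coeff_mk]
  congr 2
  omega

theorem coeff_zetaSeries_cube_eq_sum {q : ℕ} (hq : 2 ≤ q) :
    PowerSeries.coeff (q - 1) (zetaSeries ^ 3) =
      ∑ j ∈ Finset.Icc 2 (q - 2), zetaVal (q - j) *
        ∑ i ∈ Finset.Icc 0 (j - 2), zetaVal (i + 2) * zetaVal (j - i) := by
  -- `zetaSeries` has no constant term, so its square starts in degree `2`; for the same reason the
  -- last term `j = q - 1` of the convolution vanishes.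
  have hlow : ∀ j < 2, PowerSeries.coeff j (zetaSeries ^ 2) = 0 := by
    intro j hj
    interval_cases j <;>
      simp [sq, PowerSeries.coeff_mul, zetaSeries, 
        Finset.Nat.antidiagonal_succ]
  rw [pow_succ, PowerSeries.coeff_mul, Finset.Nat.sum_antidiagonal_eq_sum_range_succ_mk]
  symm
  refine Finset.sum_subset_zero_on_sdiff (fun j hj => ?_) (fun j hj => ?_) fun j hj => ?_
  · simp only [Finset.mem_Icc, Finset.mem_range] at hj ⊢
    omega
  · simp only [Finset.mem_sdiff, Finset.mem_Icc, Finset.mem_range, not_and_or, not_le] at hj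
    rcases Nat.lt_or_ge j 2 with h | h
    · simp only [hlow j h, zero_mul]
    · simp [zetaSeries, show q - 1 - j = 0 by omega]
  · simp only [Finset.mem_Icc] at hj
    rw [coeff_zetaSeries_sq_eq_sum hj.1, mul_comm]
    congr 1
    simp only [zetaSeries, PowerSeries.coeff_mk]
    rw [if_neg (by omega)]
    congr 1
    omega

theorem hasSum_genHarmonic_shift {q : ℕ} (hq : 2 ≤ q) (p : ℕ) (hp : 1 ≤ p) :
    HasSum (fun k : ℕ => genHarmonic k p * ((k : ℝ) + 1)⁻¹ ^ q)
      (eulerSum [p] q - zetaVal (p + q)) := by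
  refine ((hasSum_eulerSum_single hp hq).sub
    (hasSum_zetaVal (s := p + q) (by omega))).congr_fun fun k => ?_
  rw [genHarmonic_succ, pow_add]
  ring

theorem eulerSum_one_one_eq {q : ℕ} (hq : 2 ≤ q) : eulerSum [1, 1] q =
    eulerSum [2] q + ((q : ℝ) + 1) * ((q : ℝ) + 3) / 3 * zetaVal (q + 2)
      + zetaVal 2 * zetaVal q
      - ((q : ℝ) + 2) / 2 *
          ∑ j ∈ Finset.Icc 0 (q - 2), zetaVal (j + 2) * zetaVal (q - j)
      + 1 / 3 * ∑ j ∈ Finset.Icc 2 (q - 2), zetaVal (q - j) *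
          ∑ i ∈ Finset.Icc 0 (j - 2), zetaVal (i + 2) * zetaVal (j - i) := by
  have h1 := hasSum_genHarmonic_shift (q := q + 1) (by omega) 1 le_rfl
  have h2 := hasSum_genHarmonic_shift hq 2 (by omega)
  have h11 : HasSum (fun k : ℕ => (genHarmonic k 1 ^ 2 - (zetaVal 2 + genHarmonic k 2)) *
        ((k : ℝ) + 1)⁻¹ ^ q) _ :=
    ((((hasSum_eulerSum_pair le_rfl le_rfl hq).sub (h1.mul_left 2)).sub
      (hasSum_zetaVal (s := q + 2) (by omega))).sub h2).sub
      ((hasSum_zetaVal hq).mul_left (zetaVal 2)) |>.congr_fun fun k => by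
        rw [genHarmonic_succ, pow_succ, pow_add]
        ring
  -- Degree `q` in the square and `q - 1` in the cube are chosen so that both contain the same sum
  -- of `H_k / (k + 1)^(q+1)`, which then cancels.
  have e2 := coeff_zetaSeries_sq (m := q) (by omega)
  have e3 := coeff_zetaSeries_cube (m := q - 1) (by omega)
  rw [coeff_zetaSeries_cube_eq_sum hq] at e3
  rw [coeff_zetaSeries_sq_eq_sum hq] at e2
  rw [show q - 1 + 3 = q + 2 by omega, show q - 1 + 2 = q + 1 by omega, Nat.sub_add_cancel
    (by omega : 1 ≤ q), Nat.cast_sub (by omega : 1 ≤ q), h11.tsum_eq] at e3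
  rw [h1.tsum_eq] at e2 e3
  rw [show 1 + (q + 1) = q + 2 by omega] at e2 e3
  rw [show 2 + q = q + 2 by omega] at e3
  rw [e2, e3]
  push_cast
  ring

/-! ### Partial fractions with three poles -/

/-- The coefficients of `(1 + X)⁻ᵖ`. -/
def negBinom (p m : ℕ) : ℚ := (-1) ^ m * (p + m - 1).choose m

@[simp] theorem negBinom_zero_right (p : ℕ) : negBinom p 0 = 1 := by simp [negBinom]

theorem negBinom_zero_left {m : ℕ} (hm : m ≠ 0) : negBinom 0 m = 0 := by
  rw [negBinom, Nat.choose_eq_zero_of_lt (by omega)]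
  simp

/-- Pascal's rule, that is, `(1 + X) (1 + X)⁻ᵖ⁻¹ = (1 + X)⁻ᵖ` on coefficients. -/
theorem negBinom_succ (p m : ℕ) :
    negBinom (p + 1) (m + 1) + negBinom (p + 1) m = negBinom p (m + 1) := by
  simp only [negBinom, show p + 1 + (m + 1) - 1 = p + m + 1 by omega,
    show p + 1 + m - 1 = p + m by omega, show p + (m + 1) - 1 = p + m by omega,
    Nat.choose_succ_succ (p + m) m]
  push_cast
  ring

/-- The power series of `(κ + X)⁻ᵖ`. -/
def invPowSeries (κ : ℝ) (p : ℕ) : PowerSeries ℝ :=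
  PowerSeries.mk fun m => (negBinom p m : ℝ) * κ⁻¹ ^ (p + m)

@[simp] theorem invPowSeries_zero (κ : ℝ) : invPowSeries κ 0 = 1 := by
  ext m
  by_cases hm : m = 0
  · simp [invPowSeries, hm]
  · simp [invPowSeries, hm, negBinom_zero_left hm, PowerSeries.coeff_one]

theorem add_X_mul_invPowSeries {κ : ℝ} (hκ : κ ≠ 0) (p : ℕ) :
    (PowerSeries.C κ + PowerSeries.X) * invPowSeries κ (p + 1) = invPowSeries κ p := by
  ext m
  cases m with
  | zero =>
    simp [invPowSeries, add_mul, pow_succ]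
    field_simp
  | succ m =>
    have h : (negBinom (p + 1) (m + 1) : ℝ) + negBinom (p + 1) m = negBinom p (m + 1) := by
      exact_mod_cast negBinom_succ p m
    simp only [invPowSeries, add_mul, map_add, PowerSeries.coeff_C_mul, PowerSeries.coeff_succ_X_mul,
      PowerSeries.coeff_mk, ← h]
    rw [show p + 1 + (m + 1) = p + (m + 1) + 1 by omega, show p + 1 + m = p + (m + 1) by omega,
      pow_succ]
    field_simp

/-- The polar part of order `q` at `x = 0` of `x⁻ᵠ S(x)`. -/
def polarPart (x : ℝ) (q : ℕ) (S : PowerSeries ℝ) : ℝ :=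
  ∑ j ∈ Finset.range q, PowerSeries.coeff j S * x⁻¹ ^ (q - j)

@[simp] theorem polarPart_zero_left (x : ℝ) (S : PowerSeries ℝ) : polarPart x 0 S = 0 := by
  simp [polarPart]

theorem polarPart_one {x : ℝ} {q : ℕ} (hq : 1 ≤ q) : polarPart x q 1 = x⁻¹ ^ q := by
  obtain ⟨q, rfl⟩ : ∃ t, q = t + 1 := ⟨q - 1, by omega⟩
  rw [polarPart, Finset.sum_range_succ']
  simp [PowerSeries.coeff_one]

theorem polarPart_sub (x : ℝ) (q : ℕ) (S T : PowerSeries ℝ) :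
    polarPart x q (S - T) = polarPart x q S - polarPart x q T := by
  simp [polarPart, sub_mul, Finset.sum_sub_distrib]

theorem polarPart_C_mul (x : ℝ) (q : ℕ) (c : ℝ) (S : PowerSeries ℝ) :
    polarPart x q (PowerSeries.C c * S) = c * polarPart x q S := by
  simp [polarPart, Finset.mul_sum, mul_assoc]

theorem polarPart_X_mul (x : ℝ) (q : ℕ) (S : PowerSeries ℝ) :
    polarPart x (q + 1) (PowerSeries.X * S) = polarPart x q S := by
  simp [polarPart, Finset.sum_range_succ', PowerSeries.coeff_succ_X_mul]

/-- Write `κ = (κ + X) - X`: the first factor lowers the exponent `p + 1`, the second lowers the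
order of the pole. -/
theorem mul_polarPart_invPowSeries {κ : ℝ} (hκ : κ ≠ 0) (x : ℝ) (q p : ℕ) (S : PowerSeries ℝ) :
    κ * polarPart x (q + 1) (invPowSeries κ (p + 1) * S) =
      polarPart x (q + 1) (invPowSeries κ p * S) - polarPart x q (invPowSeries κ (p + 1) * S) := by
  rw [← polarPart_X_mul x q, ← polarPart_C_mul, ← polarPart_sub, ← add_X_mul_invPowSeries hκ p]
  congr 1
  ring

/-- The sum of the polar parts of `x⁻ᵠ y⁻ᵖ z⁻ʳ`, where the differences of `x`, `y`, `z` are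
regarded as constants. -/
def polarSum (x y z : ℝ) (q p r : ℕ) : ℝ :=
  polarPart x q (invPowSeries (y - x) p * invPowSeries (z - x) r) +
  polarPart y p (invPowSeries (x - y) q * invPowSeries (z - y) r) +
  polarPart z r (invPowSeries (x - z) q * invPowSeries (y - z) p)

theorem polarSum_swap_left (x y z : ℝ) (q p r : ℕ) :
    polarSum x y z q p r = polarSum y x z p q r := by
  rw [polarSum, polarSum, mul_comm (invPowSeries (x - z) q)]
  ring

theorem polarSum_swap_right (x y z : ℝ) (q p r : ℕ) :
    polarSum x y z q p r = polarSum x z y q r p := by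
  rw [polarSum, polarSum, mul_comm (invPowSeries (y - x) p)]
  ring

/-- This is the recursion that `(y - x) / (x y) = 1 / x - 1 / y` gives for the product of inverse
powers. At the pole `z` it comes from `y - x = ((y - z) + X) - ((x - z) + X)`. -/
theorem mul_polarSum {x y z : ℝ} (hxy : x ≠ y) (hxz : x ≠ z) (hyz : y ≠ z) (q p r : ℕ) :
    (y - x) * polarSum x y z (q + 1) (p + 1) r =
      polarSum x y z (q + 1) p r - polarSum x y z q (p + 1) r := by
  have h1 := mul_polarPart_invPowSeries (sub_ne_zero.2 hxy.symm) x q p (invPowSeries (z - x) r)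
  have h2 := mul_polarPart_invPowSeries (sub_ne_zero.2 hxy) y p q (invPowSeries (z - y) r)
  have h3 : (y - x) * polarPart z r (invPowSeries (x - z) (q + 1) * invPowSeries (y - z) (p + 1)) =
      polarPart z r (invPowSeries (x - z) (q + 1) * invPowSeries (y - z) p) -
      polarPart z r (invPowSeries (x - z) q * invPowSeries (y - z) (p + 1)) := by
    rw [← polarPart_C_mul, ← polarPart_sub, ← add_X_mul_invPowSeries (sub_ne_zero.2 hyz) p,
      ← add_X_mul_invPowSeries (sub_ne_zero.2 hxz) q]
    simp only [map_sub]
    congr 1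
    ring
  simp only [polarSum]
  linear_combination h1 - h2 + h3

/-- Both sides satisfy the recursion of `mul_polarSum`, so induction on the weight reduces to a
single nonzero exponent. Weight `0` must be excluded, since the polar sum is then `0` and not `1`.
-/
theorem inv_pow_mul_eq_polarSum {x y z : ℝ} (hx : x ≠ 0) (hy : y ≠ 0) (hz : z ≠ 0)
    (hxy : x ≠ y) (hxz : x ≠ z) (hyz : y ≠ z) {q p r : ℕ} (h : 1 ≤ q + p + r) :
    x⁻¹ ^ q * y⁻¹ ^ p * z⁻¹ ^ r = polarSum x y z q p r := by
  obtain ⟨n, hn⟩ : ∃ n, q + p + r = n + 1 := ⟨q + p + r - 1, by omega⟩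
  clear h
  induction n generalizing x y z q p r with
  | zero =>
    rcases (by omega : (q = 0 ∧ p = 0 ∧ r = 1) ∨ (q = 0 ∧ p = 1 ∧ r = 0) ∨
      (q = 1 ∧ p = 0 ∧ r = 0)) with ⟨rfl, rfl, rfl⟩ | ⟨rfl, rfl, rfl⟩ | ⟨rfl, rfl, rfl⟩ <;>
    simp [polarSum, polarPart]
  | succ n ih =>
    have step : ∀ {x y z : ℝ} {q p r : ℕ}, x ≠ 0 → y ≠ 0 → z ≠ 0 → x ≠ y → x ≠ z → y ≠ z →
        q + 1 + (p + 1) + r = n + 1 + 1 →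
        x⁻¹ ^ (q + 1) * y⁻¹ ^ (p + 1) * z⁻¹ ^ r = polarSum x y z (q + 1) (p + 1) r := by
      intro x y z q p r hx hy hz hxy hxz hyz hn
      have h1 := mul_polarSum hxy hxz hyz q p r
      rw [← ih hx hy hz hxy hxz hyz (q := q + 1) (p := p) (r := r) (by omega),
        ← ih hx hy hz hxy hxz hyz (q := q) (p := p + 1) (r := r) (by omega)] at h1
      apply mul_left_cancel₀ (sub_ne_zero.2 hxy.symm)
      rw [h1, pow_succ, pow_succ]
      field_simp
    rcases q with _ | q
    · rcases p with _ | p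
      · simp [polarSum, polarPart_one (show 1 ≤ r by omega)]
      · rcases r with _ | r
        · simp [polarSum, polarPart_one (show 1 ≤ p + 1 by omega)]
        · rw [polarSum_swap_left, polarSum_swap_right,
            ← step hy hz hx hyz hxy.symm hxz.symm (by omega)]
          ring
    · rcases p with _ | p
      · rcases r with _ | r
        · simp [polarSum, polarPart_one (show 1 ≤ q + 1 by omega)]
        · rw [polarSum_swap_right, ← step hx hz hy hxz hxy hyz.symm (by omega)]
          ring
      · exact step hx hy hz hxy hxz hyz hn

theorem inv_pow_mul_eq_polarPart_add {x y : ℝ} (hx : x ≠ 0) (hy : y ≠ 0) (hxy : x ≠ y) {q p : ℕ}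
    (h : 1 ≤ q + p) : x⁻¹ ^ q * y⁻¹ ^ p =
      polarPart x q (invPowSeries (y - x) p) + polarPart y p (invPowSeries (x - y) q) := by
  -- A dummy third pole, taken with exponent `0`.
  obtain ⟨z, hz⟩ := Infinite.exists_notMem_finset ({0, x, y} : Finset ℝ)
  simp only [Finset.mem_insert, Finset.mem_singleton, not_or] at hz
  have h1 := inv_pow_mul_eq_polarSum hx hy hz.1 hxy (Ne.symm hz.2.1) (Ne.symm hz.2.2)
    (q := q) (p := p) (r := 0) (by omega)
  simpa [polarSum] using h1

/-! ### Symmetric summation over the integers -/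

open SummationFilter in
theorem Summable.hasSum_symmetricIcc {f : ℤ → ℝ} (hf : Summable f) :
    HasSum f (∑' n, f n) (symmetricIcc ℤ) :=
  hf.hasSum.mono_left (symmetricIcc ℤ).le_atTop

/-- The symmetric sum of `1 / nʲ` over the nonzero integers. -/
def zetaInt (j : ℕ) : ℝ := if j = 1 then 0 else (1 + (-1) ^ j) * zetaVal j

theorem sum_Icc_neg_eq (h : ℤ → ℝ) (N : ℕ) :
    ∑ n ∈ Finset.Icc (-(N : ℤ)) N, h n =
      h 0 + ∑ k ∈ Finset.range N, (h (k + 1) + h (-(k + 1))) := by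
  induction N with
  | zero => simp
  | succ N ih =>
    have h1 : Finset.Icc (-((N + 1 : ℕ) : ℤ)) ((N + 1 : ℕ) : ℤ) =
        insert ((N : ℤ) + 1) (insert (-((N : ℤ) + 1)) (Finset.Icc (-(N : ℤ)) N)) := by
      ext x
      simp only [Finset.mem_Icc, Finset.mem_insert]
      push_cast
      omega
    rw [h1, Finset.sum_insert (by simp; omega), Finset.sum_insert (by simp), ih,
      Finset.sum_range_succ]
    ring

theorem sum_Icc_neg_shift (h : ℤ → ℝ) (N : ℕ) :
    ∑ n ∈ Finset.Icc (-(N : ℤ)) N, h (n - 1) =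
      ∑ n ∈ Finset.Icc (-(N : ℤ)) N, h n + h (-N - 1) - h N := by
  induction N with
  | zero => simp
  | succ N ih =>
    rw [sum_Icc_neg_eq] at ih ⊢
    rw [sum_Icc_neg_eq] at ih ⊢
    simp only [Finset.sum_range_succ, Nat.cast_add, Nat.cast_one, add_sub_cancel_right, neg_add',
      zero_sub] at ih ⊢
    linarith

open SummationFilter in
-- A unit shift changes the sum over `[-N, N]` only by two boundary terms, which tend to `0`.
theorem hasSum_symmetricIcc_sub_one_iff {h : ℤ → ℝ} {s : ℝ}
    (h1 : Tendsto (fun N : ℕ => h N) atTop (𝓝 0))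
    (h2 : Tendsto (fun N : ℕ => h (-N - 1)) atTop (𝓝 0)) :
    HasSum (fun n => h (n - 1)) s (symmetricIcc ℤ) ↔ HasSum h s (symmetricIcc ℤ) := by
  rw [hasSum_symmetricIcc_iff, hasSum_symmetricIcc_iff]
  simp only [sum_Icc_neg_shift]
  constructor
  · intro h3
    refine (by simpa using (h3.sub h2).add h1 : Tendsto _ _ (𝓝 s)).congr fun N => ?_
    ring
  · intro h3
    have := (h3.add h2).sub h1
    simpa using this

theorem tendsto_inv_natCast_add_pow (a : ℝ) {j : ℕ} (hj : 1 ≤ j) :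
    Tendsto (fun N : ℕ => ((N : ℝ) + a)⁻¹ ^ j) atTop (𝓝 0) := by
  have h : Tendsto (fun N : ℕ => ((N : ℝ) + a)⁻¹) atTop (𝓝 0) :=
    tendsto_inv_atTop_zero.comp (tendsto_atTop_add_const_right _ _ tendsto_natCast_atTop_atTop)
  simpa [show j ≠ 0 by omega] using h.pow j

open SummationFilter in
-- Shift invariance reduces to `a = 0`, where `n` and `-n` are paired. Symmetric summation is needed
-- because `j = 1` converges only conditionally.
theorem hasSum_symmetricIcc_inv_pow (a : ℤ) {j : ℕ} (hj : 1 ≤ j) :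
    HasSum (fun n : ℤ => ((n : ℝ) - a)⁻¹ ^ j) (zetaInt j) (symmetricIcc ℤ) := by
  have key : ∀ b : ℤ, HasSum (fun n : ℤ => ((n : ℝ) - (b + 1 : ℤ))⁻¹ ^ j) (zetaInt j)
      (symmetricIcc ℤ) ↔ HasSum (fun n : ℤ => ((n : ℝ) - b)⁻¹ ^ j) (zetaInt j)
      (symmetricIcc ℤ) := fun b => by
    rw [← hasSum_symmetricIcc_sub_one_iff (h := fun n : ℤ => ((n : ℝ) - b)⁻¹ ^ j)]
    · push_cast
      simp only [sub_sub, add_comm (1 : ℝ)]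
    · simpa [sub_eq_add_neg] using tendsto_inv_natCast_add_pow (-(b : ℝ)) hj
    · have h := (tendsto_inv_natCast_add_pow (1 + (b : ℝ)) hj).const_mul ((-1) ^ j)
      rw [mul_zero] at h
      refine h.congr fun N => ?_
      rw [← mul_pow, neg_one_mul, ← inv_neg]
      push_cast
      ring_nf
  induction a using Int.induction_on with
  | zero =>
    rw [hasSum_symmetricIcc_iff]
    have h1 : ∀ N : ℕ, ∑ n ∈ Finset.Icc (-(N : ℤ)) N, ((n : ℝ) - (0 : ℤ))⁻¹ ^ j =
        (1 + (-1) ^ j) * ∑ k ∈ Finset.range N, ((k : ℝ) + 1)⁻¹ ^ j := fun N => by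
      rw [sum_Icc_neg_eq (fun n : ℤ => ((n : ℝ) - (0 : ℤ))⁻¹ ^ j), Finset.mul_sum]
      simp only [Int.cast_zero, sub_zero, inv_zero, zero_pow (show j ≠ 0 by omega), zero_add]
      refine Finset.sum_congr rfl fun k _ => ?_
      push_cast
      rw [add_mul, ← mul_pow, neg_one_mul, ← inv_neg, one_mul]
    simp only [h1, zetaInt]
    split_ifs with hj1
    · subst hj1
      simp
    · exact (tendsto_sum_range_inv_pow (by omega)).const_mul _
  | succ b ih => exact (key b).2 ih
  | pred b ih =>
    rw [← key]
    simpa using ih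

/-- The symmetric sum over the integers of a polar part. -/
def polarInt (q : ℕ) (S : PowerSeries ℝ) : ℝ :=
  ∑ j ∈ Finset.range q, PowerSeries.coeff j S * zetaInt (q - j)

open SummationFilter in
theorem hasSum_symmetricIcc_polarPart (a : ℤ) (q : ℕ) (S : PowerSeries ℝ) :
    HasSum (fun n : ℤ => polarPart ((n : ℝ) - a) q S) (polarInt q S) (symmetricIcc ℤ) :=
  hasSum_sum fun j hj => (hasSum_symmetricIcc_inv_pow a
    (by have := Finset.mem_range.1 hj; omega)).mul_left _

@[simp] theorem polarPart_zero (q : ℕ) (S : PowerSeries ℝ) : polarPart 0 q S = 0 :=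
  Finset.sum_eq_zero fun j hj => by
    have := Finset.mem_range.1 hj
    simp [show q - j ≠ 0 by omega]

/-- Partial fractions fail at `n = 0` and `n = k`, where the summand is `0` by convention. One polar
part also vanishes there, and the value of the other is subtracted. -/
theorem tsum_inv_pow_mul_inv_pow {k : ℤ} (hk : k ≠ 0) {q p : ℕ} (hq : 1 ≤ q) (hp : 1 ≤ p)
    (hs : Summable fun n : ℤ => (n : ℝ)⁻¹ ^ q * ((n : ℝ) - k)⁻¹ ^ p) :
    ∑' n : ℤ, (n : ℝ)⁻¹ ^ q * ((n : ℝ) - k)⁻¹ ^ p =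
      (polarInt q (invPowSeries (-k) p) - polarPart k q (invPowSeries (-k) p)) +
      (polarInt p (invPowSeries k q) - polarPart (-k) p (invPowSeries k q)) := by
  have h1 := (hasSum_symmetricIcc_polarPart 0 q (invPowSeries (-k) p)).add
    (hasSum_symmetricIcc_polarPart k p (invPowSeries k q))
  have h2 := (h1.sub (hasSum_ite_eq 0 (polarPart (-k) p (invPowSeries k q)) _)).sub
    (hasSum_ite_eq k (polarPart k q (invPowSeries (-k) p)) _)
  have h3 : (fun n : ℤ => (n : ℝ)⁻¹ ^ q * ((n : ℝ) - k)⁻¹ ^ p) =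
      fun n : ℤ => polarPart (n - (0 : ℤ)) q (invPowSeries (-k) p) +
      polarPart (n - k) p (invPowSeries k q) -
      (if n = 0 then polarPart (-k) p (invPowSeries k q) else 0) -
      (if n = k then polarPart k q (invPowSeries (-k) p) else 0) := by
    funext n
    by_cases hn0 : n = 0
    · subst hn0
      simp [hk.symm, show q ≠ 0 by omega]
    by_cases hnk : n = k
    · subst hnk
      simp [hk, show p ≠ 0 by omega]
    have hn0' : (n : ℝ) ≠ 0 := by exact_mod_cast hn0
    have hnk' : (n : ℝ) - k ≠ 0 := sub_ne_zero.2 (by exact_mod_cast hnk)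
    have hk' : (k : ℝ) ≠ 0 := by exact_mod_cast hk
    rw [inv_pow_mul_eq_polarPart_add hn0' hnk' (fun h => hk' (by linarith)) (by omega)]
    simp [hn0, hnk]
  rw [← h3] at h2
  rw [hs.hasSum_symmetricIcc.unique h2]
  ring

theorem tsum_inv_pow_mul_inv_pow_mul_inv_pow {k l : ℤ} (hk : k ≠ 0) (hl : l ≠ 0) (hkl : k ≠ l)
    {q p r : ℕ} (hq : 1 ≤ q) (hp : 1 ≤ p) (hr : 1 ≤ r)
    (hs : Summable fun n : ℤ => (n : ℝ)⁻¹ ^ q * ((n : ℝ) - k)⁻¹ ^ p * ((n : ℝ) - l)⁻¹ ^ r)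
    {S₁ S₂ S₃ : PowerSeries ℝ} (h₁ : S₁ = invPowSeries (-k) p * invPowSeries (-l) r)
    (h₂ : S₂ = invPowSeries k q * invPowSeries (k - l) r)
    (h₃ : S₃ = invPowSeries l q * invPowSeries (l - k) p) :
    ∑' n : ℤ, (n : ℝ)⁻¹ ^ q * ((n : ℝ) - k)⁻¹ ^ p * ((n : ℝ) - l)⁻¹ ^ r =
      (polarInt q S₁ - polarPart k q S₁ - polarPart l q S₁) +
      (polarInt p S₂ - polarPart (-k) p S₂ - polarPart (l - k) p S₂) +
      (polarInt r S₃ - polarPart (-l) r S₃ - polarPart (k - l) r S₃) := by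
  have h4 := ((hasSum_symmetricIcc_polarPart 0 q S₁).add
    (hasSum_symmetricIcc_polarPart k p S₂)).add (hasSum_symmetricIcc_polarPart l r S₃)
  have h5 := ((h4.sub (hasSum_ite_eq 0 (polarPart (-k) p S₂ + polarPart (-l) r S₃) _)).sub
    (hasSum_ite_eq k (polarPart k q S₁ + polarPart (k - l) r S₃) _)).sub
    (hasSum_ite_eq l (polarPart l q S₁ + polarPart (l - k) p S₂) _)
  have hk' : (k : ℝ) ≠ 0 := by exact_mod_cast hk
  have hl' : (l : ℝ) ≠ 0 := by exact_mod_cast hl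
  have hkl' : (k : ℝ) ≠ l := by exact_mod_cast hkl
  have h6 : (fun n : ℤ => (n : ℝ)⁻¹ ^ q * ((n : ℝ) - k)⁻¹ ^ p * ((n : ℝ) - l)⁻¹ ^ r) =
      fun n : ℤ => polarPart (n - (0 : ℤ)) q S₁ + polarPart (n - k) p S₂ +
        polarPart (n - l) r S₃ -
      (if n = 0 then polarPart (-k) p S₂ + polarPart (-l) r S₃ else 0) -
      (if n = k then polarPart k q S₁ + polarPart (k - l) r S₃ else 0) -
      (if n = l then polarPart l q S₁ + polarPart (l - k) p S₂ else 0) := by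
    funext n
    by_cases hn0 : n = 0
    · subst hn0
      simp [hk.symm, hl.symm, show q ≠ 0 by omega]
    by_cases hnk : n = k
    · subst hnk
      simp [hk, hkl, show p ≠ 0 by omega]
    by_cases hnl : n = l
    · subst hnl
      simp [hl, hkl.symm, show r ≠ 0 by omega]
    have hn0' : (n : ℝ) ≠ 0 := by exact_mod_cast hn0
    have hnk' : (n : ℝ) - k ≠ 0 := sub_ne_zero.2 (by exact_mod_cast hnk)
    have hnl' : (n : ℝ) - l ≠ 0 := sub_ne_zero.2 (by exact_mod_cast hnl)
    rw [inv_pow_mul_eq_polarSum hn0' hnk' hnl' (fun h => hk' (by linarith))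
      (fun h => hl' (by linarith)) (fun h => hkl' (by linarith)) (by omega), polarSum, h₁, h₂, h₃]
    simp [hn0, hnk, hnl]
  rw [← h6] at h5
  rw [hs.hasSum_symmetricIcc.unique h5]
  ring

/-! ### Families whose sum reduces -/

/-- The family `f` is summable and its sum reduces in weight `w`. -/
def SumReduces {σ β : Type*} (wt : σ → ℕ) (v : σ → ℝ) (w : ℕ) (f : β → ℝ) : Prop :=
  Summable f ∧ Reduces wt v w (∑' b, f b)

namespace SumReduces

variable {σ β γ : Type*} {wt : σ → ℕ} {v : σ → ℝ} {w w' : ℕ} {f g : β → ℝ}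

theorem of_hasSum {s : ℝ} (h : HasSum f s) (hs : Reduces wt v w s) : SumReduces wt v w f :=
  ⟨h.summable, h.tsum_eq.symm ▸ hs⟩

theorem reduces {s : ℝ} (hf : SumReduces wt v w f) (h : HasSum f s) : Reduces wt v w s :=
  h.tsum_eq ▸ hf.2

theorem add (hf : SumReduces wt v w f) (hg : SumReduces wt v w g) :
    SumReduces wt v w fun b => f b + g b :=
  of_hasSum (hf.1.hasSum.add hg.1.hasSum) (hf.2.add hg.2)

theorem sub (hf : SumReduces wt v w f) (hg : SumReduces wt v w g) :
    SumReduces wt v w fun b => f b - g b :=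
  of_hasSum (hf.1.hasSum.sub hg.1.hasSum) (hf.2.sub hg.2)

theorem rat_mul (c : ℚ) (hf : SumReduces wt v w f) : SumReduces wt v w fun b => c * f b :=
  of_hasSum (hf.1.hasSum.mul_left _) (hf.2.rat_mul c)

theorem mul_right {c : ℝ} (hf : SumReduces wt v w f) (hc : Reduces wt v w' c) :
    SumReduces wt v (w + w') fun b => f b * c :=
  of_hasSum (hf.1.hasSum.mul_right _) (hf.2.mul hc)

theorem sum {ι : Type*} {s : Finset ι} {f : ι → β → ℝ} (h : ∀ i ∈ s, SumReduces wt v w (f i)) :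
    SumReduces wt v w fun b => ∑ i ∈ s, f i b :=
  of_hasSum (hasSum_sum fun i hi => (h i hi).1.hasSum) (Reduces.sum fun i hi => (h i hi).2)

theorem congr (hf : SumReduces wt v w f) (h : ∀ b, g b = f b) (hw : w = w') :
    SumReduces wt v w' g := by
  rw [funext h]
  exact hw ▸ hf

theorem comp_equiv (e : γ ≃ β) (hf : SumReduces wt v w f) :
    SumReduces wt v w fun c => f (e c) :=
  of_hasSum (e.hasSum_iff.2 hf.1.hasSum) hf.2

end SumReduces

section

variable {σ β : Type*} {wt : σ → ℕ} {v : σ → ℝ}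

theorem reduces_zetaInt (hz : ∀ s, 2 ≤ s → Reduces wt v s (zetaVal s)) {j : ℕ} (hj : 1 ≤ j) :
    Reduces wt v j (zetaInt j) := by
  rw [zetaInt]
  split_ifs with h
  · exact .zero
  · simpa using (hz j (by omega)).rat_mul (1 + (-1) ^ j)

theorem sumReduces_polarInt (hz : ∀ s, 2 ≤ s → Reduces wt v s (zetaVal s)) {m q : ℕ}
    {S : β → PowerSeries ℝ}
    (h : ∀ j < q, SumReduces wt v (m + j) fun b => PowerSeries.coeff j (S b)) :
    SumReduces wt v (m + q) fun b => polarInt q (S b) := by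
  refine SumReduces.sum fun j hj => ?_
  have hj' := Finset.mem_range.1 hj
  exact ((h j hj').mul_right (reduces_zetaInt hz (show 1 ≤ q - j by omega))).congr (fun _ => rfl)
    (by omega)

theorem inv_neg_pow (x : ℝ) (u : ℕ) : (-x)⁻¹ ^ u = (((-1) ^ u : ℚ) : ℝ) * x⁻¹ ^ u := by
  push_cast
  rw [← mul_pow, neg_one_mul, ← inv_neg]

theorem sumReduces_two_pole (hz : ∀ s, 2 ≤ s → Reduces wt v s (zetaVal s)) {κ : β → ℝ}
    (hκ : ∀ u, 2 ≤ u → SumReduces wt v u fun b => (κ b)⁻¹ ^ u) {p : ℕ} (hp : 2 ≤ p) (q : ℕ) :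
    SumReduces wt v (p + q) fun b =>
      polarInt q (invPowSeries (κ b) p) - polarPart (-κ b) q (invPowSeries (κ b) p) := by
  refine SumReduces.sub (sumReduces_polarInt hz fun j _ => ?_) (SumReduces.sum fun j hj => ?_)
  · simp only [invPowSeries, PowerSeries.coeff_mk]
    exact (hκ (p + j) (by omega)).rat_mul _
  · have hj' := Finset.mem_range.1 hj
    refine ((hκ (p + q) (by omega)).rat_mul (negBinom p j * (-1) ^ (q - j))).congr (fun b => ?_) rfl
    rw [invPowSeries, PowerSeries.coeff_mk, inv_neg_pow, show p + q = (p + j) + (q - j) by omega,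
      pow_add (κ b)⁻¹ (p + j)]
    push_cast
    ring

/-- The contribution of one pole to the sum over `n`, with `κ` and `μ` its differences to the other
two. Expanding only raises the exponents `p` and `r`, so `h` always applies. -/
theorem sumReduces_three_pole (hz : ∀ s, 2 ≤ s → Reduces wt v s (zetaVal s)) {κ μ : β → ℝ}
    (h : ∀ u w, 2 ≤ u → 2 ≤ w → SumReduces wt v (u + w) fun b => (κ b)⁻¹ ^ u * (μ b)⁻¹ ^ w)
    {p r : ℕ} (hp : 2 ≤ p) (hr : 2 ≤ r) (q : ℕ) :
    SumReduces wt v (p + r + q) fun b =>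
      polarInt q (invPowSeries (κ b) p * invPowSeries (μ b) r) -
      polarPart (-κ b) q (invPowSeries (κ b) p * invPowSeries (μ b) r) -
      polarPart (-μ b) q (invPowSeries (κ b) p * invPowSeries (μ b) r) := by
  refine SumReduces.sub (SumReduces.sub (sumReduces_polarInt hz fun j _ => ?_)
    (SumReduces.sum fun j hj => ?_)) (SumReduces.sum fun j hj => ?_)
  · simp only [invPowSeries, PowerSeries.coeff_mul, PowerSeries.coeff_mk]
    refine SumReduces.sum fun a ha => ?_
    have ha' := Finset.HasAntidiagonal.mem_antidiagonal.1 ha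
    refine ((h (p + a.1) (r + a.2) (by omega) (by omega)).rat_mul
      (negBinom p a.1 * negBinom r a.2)).congr (fun b => ?_) (by omega)
    push_cast
    ring
  · have hj' := Finset.mem_range.1 hj
    simp only [invPowSeries, PowerSeries.coeff_mul, PowerSeries.coeff_mk, Finset.sum_mul]
    refine SumReduces.sum fun a ha => ?_
    have ha' := Finset.HasAntidiagonal.mem_antidiagonal.1 ha
    refine ((h (p + a.1 + (q - j)) (r + a.2) (by omega) (by omega)).rat_mul
      (negBinom p a.1 * negBinom r a.2 * (-1) ^ (q - j))).congr (fun b => ?_) (by omega)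
    rw [inv_neg_pow, pow_add (κ b)⁻¹ (p + a.1)]
    push_cast
    ring
  · have hj' := Finset.mem_range.1 hj
    simp only [invPowSeries, PowerSeries.coeff_mul, PowerSeries.coeff_mk, Finset.sum_mul]
    refine SumReduces.sum fun a ha => ?_
    have ha' := Finset.HasAntidiagonal.mem_antidiagonal.1 ha
    refine ((h (p + a.1) (r + a.2 + (q - j)) (by omega) (by omega)).rat_mul
      (negBinom p a.1 * negBinom r a.2 * (-1) ^ (q - j))).congr (fun b => ?_) (by omega)
    rw [inv_neg_pow, pow_add (μ b)⁻¹ (r + a.2)]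
    push_cast
    ring

end

/-! ### Sums over one positive integer of inverse powers of a difference -/

/-- Terms with `l < k` give the harmonic number, `l = k` gives `0`, and `l > k` gives the signed
zeta value. -/
theorem hasSum_inv_sub_pow {p : ℕ} (hp : 2 ≤ p) (k : ℕ) :
    HasSum (fun l : ℕ => (((k : ℝ) + 1) - ((l : ℝ) + 1))⁻¹ ^ p)
      (genHarmonic k p + (-1) ^ p * zetaVal p) := by
  have h1 : HasSum (fun l : ℕ => (((k : ℝ) + 1) - (((l + (k + 1) : ℕ) : ℝ) + 1))⁻¹ ^ p)
      ((-1) ^ p * zetaVal p) := by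
    refine ((hasSum_zetaVal hp).mul_left ((-1) ^ p)).congr_fun fun l => ?_
    rw [← mul_pow, neg_one_mul, ← inv_neg]
    push_cast
    congr 2
    ring
  have h2 := (hasSum_nat_add_iff (f := fun l : ℕ => (((k : ℝ) + 1) - ((l : ℝ) + 1))⁻¹ ^ p)
    (k + 1)).1 h1
  refine (?_ : _ = genHarmonic k p + (-1) ^ p * zetaVal p) ▸ h2
  rw [add_comm, Finset.sum_range_succ, genHarmonic_eq_sum_range, ← Finset.sum_range_reflect]
  simp only [sub_self, inv_zero, zero_pow (show p ≠ 0 by omega), add_zero]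
  congr 1
  refine Finset.sum_congr rfl fun j hj => ?_
  have hj' := Finset.mem_range.1 hj
  have : ((k - 1 - j : ℕ) : ℝ) = (k : ℝ) - 1 - j := by
    rw [Nat.cast_sub (by omega), Nat.cast_sub (by omega)]; simp
  rw [this]
  congr 2
  ring

theorem hasSum_inv_neg_sub_pow {p : ℕ} (hp : 2 ≤ p) (k : ℕ) :
    HasSum (fun l : ℕ => (-((k : ℝ) + 1) - ((l : ℝ) + 1))⁻¹ ^ p)
      ((-1) ^ p * (zetaVal p - genHarmonic (k + 1) p)) := by
  have h1 := (hasSum_nat_add_iff' (k + 1)).2 (hasSum_zetaVal hp)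
  rw [← genHarmonic_eq_sum_range] at h1
  refine (h1.mul_left ((-1) ^ p)).congr_fun fun l => ?_
  rw [← mul_pow, neg_one_mul, ← inv_neg]
  push_cast
  congr 2
  ring

theorem hasSum_int_of_nat {g : ℤ → ℝ} {s t : ℝ} (h0 : g 0 = 0)
    (h1 : HasSum (fun k : ℕ => g ((k : ℤ) + 1)) s)
    (h2 : HasSum (fun k : ℕ => g (-((k : ℤ) + 1))) t) : HasSum g (s + t) := by
  refine HasSum.of_nat_of_neg_add_one ?_ h2
  have h3 : HasSum (fun n : ℕ => g ((n + 1 : ℕ) : ℤ)) s := by simpa using h1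
  simpa [h0] using (hasSum_nat_add_iff (f := fun n : ℕ => g n) 1).1 h3

theorem summable_int_inv_pow {q : ℕ} (hq : 2 ≤ q) : Summable fun n : ℤ => (n : ℝ)⁻¹ ^ q := by
  have h := Real.summable_one_div_int_pow (p := q).2 (by omega)
  simpa using h

theorem summable_mul_prod {α β : Type*} {f : α → ℝ} {g : β → ℝ} (hf : Summable f)
    (hg : Summable g) : Summable fun x : α × β => f x.1 * g x.2 :=
  summable_mul_of_summable_norm (f := f) (g := g) hf.norm hg.norm

theorem summable_int_mul_int {q p : ℕ} (hq : 2 ≤ q) (hp : 2 ≤ p) :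
    Summable fun x : ℤ × ℤ => (x.1 : ℝ)⁻¹ ^ q * (x.2 : ℝ)⁻¹ ^ p := by
  have h := summable_mul_prod (summable_int_inv_pow hq) (summable_int_inv_pow hp)
  exact h

theorem summable_int_mul_int_mul_int {q p r : ℕ} (hq : 2 ≤ q) (hp : 2 ≤ p) (hr : 2 ≤ r) :
    Summable fun x : ℤ × (ℤ × ℤ) =>
      (x.1 : ℝ)⁻¹ ^ q * ((x.2.1 : ℝ)⁻¹ ^ p * (x.2.2 : ℝ)⁻¹ ^ r) := by
  have h := summable_mul_prod (summable_int_inv_pow hq) (summable_int_mul_int hp hr)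
  exact h

section

variable {σ : Type*} {wt : σ → ℕ} {v : σ → ℝ}

/-! ### Linear sums of odd weight -/

theorem sumReduces_inv_pow (hz : ∀ s, 2 ≤ s → Reduces wt v s (zetaVal s)) {u : ℕ} (hu : 2 ≤ u) :
    SumReduces wt v u fun k : ℕ => ((k : ℝ) + 1)⁻¹ ^ u :=
  .of_hasSum (hasSum_zetaVal hu) (hz u hu)

/-- The injection `(n, k) ↦ (n, n - k)` compares with a product of two convergent series over the
integers. -/
theorem summable_int_nat {q p : ℕ} (hq : 2 ≤ q) (hp : 2 ≤ p) :
    Summable fun x : ℤ × ℕ => (x.1 : ℝ)⁻¹ ^ q * ((x.1 : ℝ) - ((x.2 : ℝ) + 1))⁻¹ ^ p := by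
  have h := (summable_int_mul_int hq hp).comp_injective
    (i := fun x : ℤ × ℕ => (x.1, x.1 - ((x.2 : ℤ) + 1))) (fun x y h => by
      simp only [Prod.mk.injEq] at h
      ext <;> omega)
  refine h.congr fun x => ?_
  simp

theorem sumReduces_tsum_int (hz : ∀ s, 2 ≤ s → Reduces wt v s (zetaVal s)) {q p : ℕ} (hq : 2 ≤ q)
    (hp : 2 ≤ p) : SumReduces wt v (q + p) fun k : ℕ =>
      ∑' n : ℤ, (n : ℝ)⁻¹ ^ q * ((n : ℝ) - ((k : ℝ) + 1))⁻¹ ^ p := by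
  have h1 := sumReduces_two_pole hz (κ := fun k : ℕ => -((k : ℝ) + 1)) (fun u hu =>
    ((sumReduces_inv_pow hz hu).rat_mul ((-1) ^ u)).congr (fun k => inv_neg_pow _ _) rfl) hp q
  have h2 := sumReduces_two_pole hz (κ := fun k : ℕ => (k : ℝ) + 1)
    (fun u hu => sumReduces_inv_pow hz hu) hq p
  refine ((h1.congr (fun _ => rfl) (add_comm _ _)).add h2).congr (fun k => ?_) rfl
  have hs : Summable fun n : ℤ => (n : ℝ)⁻¹ ^ q * ((n : ℝ) - ((k + 1 : ℤ) : ℝ))⁻¹ ^ p :=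
    ((summable_int_nat hq hp).comp_injective (i := fun n : ℤ => (n, k))
      fun x y h => (Prod.mk.injEq _ _ _ _ ▸ h).1).congr fun n => by simp
  have h3 := tsum_inv_pow_mul_inv_pow (k := (k : ℤ) + 1) (by omega) (by omega) (by omega) hs
  push_cast at h3
  rw [h3, neg_neg]

/-- The double sum `T` is evaluated in both orders. In odd weight the contributions of `n > 0` and
`n < 0` each contain `+S_{p,q}`, whence the factor `1 / 2`. -/
theorem reduces_eulerSum_single (hz : ∀ s, 2 ≤ s → Reduces wt v s (zetaVal s)) {p q : ℕ}
    (hp : 2 ≤ p) (hq : 2 ≤ q) (hodd : Odd (q + p)) : Reduces wt v (q + p) (eulerSum [p] q) := by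
  have hs := summable_int_nat hq hp
  set T := ∑' x : ℤ × ℕ, (x.1 : ℝ)⁻¹ ^ q * ((x.1 : ℝ) - ((x.2 : ℝ) + 1))⁻¹ ^ p
  have hred : Reduces wt v (q + p) T := by
    refine (sumReduces_tsum_int hz hq hp).reduces ?_
    have h1 := (Equiv.prodComm ℕ ℤ).hasSum_iff.2 hs.hasSum
    exact h1.prod_fiberwise fun k => (h1.summable.prod_factor k).hasSum
  have h2 : HasSum (fun n : ℤ => ∑' k : ℕ, (n : ℝ)⁻¹ ^ q * ((n : ℝ) - ((k : ℝ) + 1))⁻¹ ^ p) T :=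
    hs.hasSum.prod_fiberwise fun n => (hs.prod_factor n).hasSum
  have hsign : (-1 : ℝ) ^ q * (-1) ^ p = -1 := by rw [← pow_add, hodd.neg_one_pow]
  have h3 := hasSum_int_of_nat (g := fun n : ℤ =>
      ∑' k : ℕ, (n : ℝ)⁻¹ ^ q * ((n : ℝ) - ((k : ℝ) + 1))⁻¹ ^ p)
    (s := eulerSum [p] q - zetaVal (p + q) + (-1) ^ p * zetaVal p * zetaVal q)
    (t := eulerSum [p] q - zetaVal p * zetaVal q) (by simp [show q ≠ 0 by omega])
    (((hasSum_genHarmonic_shift hq p (by omega)).add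
      ((hasSum_zetaVal hq).mul_left ((-1) ^ p * zetaVal p))).congr_fun fun k => by
        push_cast
        rw [((hasSum_inv_sub_pow hp k).mul_left _).tsum_eq]
        ring)
    (((hasSum_eulerSum_single (by omega) hq).sub
      ((hasSum_zetaVal hq).mul_left (zetaVal p))).congr_fun fun k => by
        push_cast
        rw [((hasSum_inv_neg_sub_pow hp k).mul_left _).tsum_eq, ← neg_one_mul ((k : ℝ) + 1),
          mul_inv, mul_pow]
        linear_combination (((k : ℝ) + 1)⁻¹ ^ q * (zetaVal p - genHarmonic (k + 1) p)) * hsign)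
  have h4 := h2.unique h3
  have h5 : eulerSum [p] q = ((1 / 2 : ℚ) : ℝ) * (T + zetaVal (p + q) -
      (((-1) ^ p - 1 : ℚ) : ℝ) * (zetaVal p * zetaVal q)) := by
    push_cast
    linear_combination (-1 / 2) * h4
  rw [h5]
  exact ((hred.add ((hz (p + q) (by omega)).congr_weight (add_comm _ _))).sub
    ((((hz p hp).mul (hz q hq)).rat_mul _).congr_weight (add_comm _ _))).rat_mul _

/-! ### Quadratic sums of even weight -/

/-- Ordered pairs of distinct natural numbers. -/
abbrev OffDiagonal : Type := {x : ℕ × ℕ // x.1 ≠ x.2}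

theorem hasSum_mul_prod {f g : ℕ → ℝ} {s t : ℝ} (hf : HasSum f s) (hg : HasSum g t) :
    HasSum (fun x : ℕ × ℕ => f x.1 * g x.2) (s * t) := by
  have h := summable_mul_prod hf.summable hg.summable
  exact hf.mul hg h

theorem hasSum_offDiagonal_iff {g : ℕ × ℕ → ℝ} {s t : ℝ} (h : HasSum (fun k => g (k, k)) s) :
    HasSum (fun x : OffDiagonal => g x.1) t ↔ HasSum g (s + t) := by
  let e : ℕ ≃ {x : ℕ × ℕ | x.1 = x.2} :=
    ⟨fun k => ⟨(k, k), rfl⟩, fun x => x.1.1, fun _ => rfl, fun x => by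
      apply Subtype.ext
      exact Prod.ext rfl x.2⟩
  have h1 : HasSum (g ∘ ((↑) : {x : ℕ × ℕ | x.1 = x.2} → ℕ × ℕ)) s := e.hasSum_iff.1 h
  exact h1.hasSum_compl_iff

theorem sumReduces_offDiagonal_mul (hz : ∀ s, 2 ≤ s → Reduces wt v s (zetaVal s)) {a b : ℕ}
    (ha : 2 ≤ a) (hb : 2 ≤ b) : SumReduces wt v (a + b) fun x : OffDiagonal =>
      ((x.1.1 : ℝ) + 1)⁻¹ ^ a * ((x.1.2 : ℝ) + 1)⁻¹ ^ b := by
  have h1 := hasSum_mul_prod (hasSum_zetaVal ha) (hasSum_zetaVal hb)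
  have h2 : HasSum (fun k : ℕ => ((k : ℝ) + 1)⁻¹ ^ a * ((k : ℝ) + 1)⁻¹ ^ b) (zetaVal (a + b)) := by
    simpa only [← pow_add] using hasSum_zetaVal (s := a + b) (by omega)
  have h3 := (hasSum_offDiagonal_iff (g := fun x : ℕ × ℕ => ((x.1 : ℝ) + 1)⁻¹ ^ a *
    ((x.2 : ℝ) + 1)⁻¹ ^ b) h2 (t := zetaVal a * zetaVal b - zetaVal (a + b))).2
    (by rwa [add_sub_cancel])
  exact .of_hasSum h3 (((hz a ha).mul (hz b hb)).sub (hz _ (by omega)))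

/-- Summing over the second entry leaves `H_k^{(b)}` plus a constant, hence the linear sum
`S_{b,a}`; the diagonal adds nothing, its terms being `0`. -/
theorem sumReduces_offDiagonal_sub (hz : ∀ s, 2 ≤ s → Reduces wt v s (zetaVal s))
    (hl : ∀ p q, 1 ≤ p → 2 ≤ q → Reduces wt v (p + q) (eulerSum [p] q)) {a b : ℕ}
    (ha : 2 ≤ a) (hb : 2 ≤ b) : SumReduces wt v (a + b) fun x : OffDiagonal =>
      ((x.1.1 : ℝ) + 1)⁻¹ ^ a * (((x.1.1 : ℝ) + 1) - ((x.1.2 : ℝ) + 1))⁻¹ ^ b := by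
  have hs : Summable fun x : ℕ × ℕ =>
      ((x.1 : ℝ) + 1)⁻¹ ^ a * (((x.1 : ℝ) + 1) - ((x.2 : ℝ) + 1))⁻¹ ^ b := by
    have h := (summable_int_nat ha hb).comp_injective
      (i := fun x : ℕ × ℕ => ((x.1 : ℤ) + 1, x.2)) (fun x y h => by
        simp only [Prod.mk.injEq] at h
        ext <;> omega)
    refine h.congr fun x => ?_
    simp
  have h1 : HasSum (fun k : ℕ => ((k : ℝ) + 1)⁻¹ ^ a * (genHarmonic k b + (-1) ^ b * zetaVal b)) _ :=
    hs.hasSum.prod_fiberwise fun k => (hasSum_inv_sub_pow hb k).mul_left _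
  have h2 : HasSum (fun k : ℕ => ((k : ℝ) + 1)⁻¹ ^ a * (genHarmonic k b + (-1) ^ b * zetaVal b))
      (eulerSum [b] a - zetaVal (b + a) + (-1) ^ b * zetaVal b * zetaVal a) :=
    ((hasSum_genHarmonic_shift ha b (by omega)).add
      ((hasSum_zetaVal ha).mul_left ((-1) ^ b * zetaVal b))).congr_fun fun k => by ring
  have h3 := hs.hasSum
  rw [h1.unique h2] at h3
  have h4 : Function.support (fun x : ℕ × ℕ =>
      ((x.1 : ℝ) + 1)⁻¹ ^ a * (((x.1 : ℝ) + 1) - ((x.2 : ℝ) + 1))⁻¹ ^ b) ⊆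
      {x : ℕ × ℕ | x.1 ≠ x.2} := fun x hx h => by
    apply hx
    simp only [h, sub_self, inv_zero, zero_pow (show b ≠ 0 by omega), mul_zero]
  refine .of_hasSum ((hasSum_subtype_iff_of_support_subset h4).2 h3) ?_
  rw [mul_assoc]
  exact (((hl b a (by omega) ha).sub (hz (b + a) (by omega))).add
    (((hz b hb).mul (hz a ha)).neg_one_pow_mul b)).congr_weight (add_comm _ _)

/-- Interchanging the entries of a pair of distinct numbers. -/
def offDiagonalSwap : OffDiagonal ≃ OffDiagonal :=
  (Equiv.prodComm ℕ ℕ).subtypeEquiv fun _ => ne_comm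

theorem summable_int_nat_nat {q p r : ℕ} (hq : 2 ≤ q) (hp : 2 ≤ p) (hr : 2 ≤ r) :
    Summable fun x : ℤ × (ℕ × ℕ) => (x.1 : ℝ)⁻¹ ^ q * ((x.1 : ℝ) - ((x.2.1 : ℝ) + 1))⁻¹ ^ p *
      ((x.1 : ℝ) - ((x.2.2 : ℝ) + 1))⁻¹ ^ r := by
  have h := (summable_int_mul_int_mul_int hq hp hr).comp_injective
    (i := fun x : ℤ × (ℕ × ℕ) => (x.1, (x.1 - ((x.2.1 : ℤ) + 1), x.1 - ((x.2.2 : ℤ) + 1))))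
    (fun x y h => by
      simp only [Prod.mk.injEq] at h
      ext <;> omega)
  refine h.congr fun x => ?_
  simp [mul_assoc]

theorem sumReduces_tsum_int_offDiagonal (hz : ∀ s, 2 ≤ s → Reduces wt v s (zetaVal s))
    (hl : ∀ p q, 1 ≤ p → 2 ≤ q → Reduces wt v (p + q) (eulerSum [p] q)) {q p r : ℕ}
    (hq : 2 ≤ q) (hp : 2 ≤ p) (hr : 2 ≤ r) :
    SumReduces wt v (q + p + r) fun x : OffDiagonal =>
      ∑' n : ℤ, (n : ℝ)⁻¹ ^ q * ((n : ℝ) - ((x.1.1 : ℝ) + 1))⁻¹ ^ p *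
        ((n : ℝ) - ((x.1.2 : ℝ) + 1))⁻¹ ^ r := by
  have h1 := sumReduces_three_pole hz (κ := fun x : OffDiagonal => -((x.1.1 : ℝ) + 1))
    (μ := fun x : OffDiagonal => -((x.1.2 : ℝ) + 1)) (fun a b ha hb =>
      ((sumReduces_offDiagonal_mul hz ha hb).rat_mul ((-1) ^ a * (-1) ^ b)).congr (fun x => by
        simp only [inv_neg_pow]
        push_cast
        ring) rfl) hp hr q
  have h2 := sumReduces_three_pole hz (κ := fun x : OffDiagonal => (x.1.1 : ℝ) + 1)
    (μ := fun x : OffDiagonal => ((x.1.1 : ℝ) + 1) - ((x.1.2 : ℝ) + 1))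
    (fun a b ha hb => sumReduces_offDiagonal_sub hz hl ha hb) hq hr p
  have h3 := sumReduces_three_pole hz (κ := fun x : OffDiagonal => (x.1.2 : ℝ) + 1)
    (μ := fun x : OffDiagonal => ((x.1.2 : ℝ) + 1) - ((x.1.1 : ℝ) + 1))
    (fun a b ha hb => (sumReduces_offDiagonal_sub hz hl ha hb).comp_equiv offDiagonalSwap) hq hp r
  refine (((h1.congr (w' := q + p + r) (fun _ => rfl) (by omega)).add
    (h2.congr (fun _ => rfl) (by omega))).add (h3.congr (fun _ => rfl) (by omega))).congr
    (fun x => ?_) rfl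
  obtain ⟨⟨k, l⟩, hkl⟩ := x
  have hs : Summable fun n : ℤ => (n : ℝ)⁻¹ ^ q * ((n : ℝ) - ((k + 1 : ℤ) : ℝ))⁻¹ ^ p *
      ((n : ℝ) - ((l + 1 : ℤ) : ℝ))⁻¹ ^ r :=
    ((summable_int_nat_nat hq hp hr).comp_injective (i := fun n : ℤ => (n, (k, l)))
      fun x y h => (Prod.mk.injEq _ _ _ _ ▸ h).1).congr fun n => by simp
  have h4 := tsum_inv_pow_mul_inv_pow_mul_inv_pow (k := (k : ℤ) + 1) (l := (l : ℤ) + 1)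
    (by omega) (by omega) (by simpa using hkl) (by omega) (by omega) (by omega) hs rfl rfl rfl
  push_cast at h4
  rw [h4]
  simp only [neg_neg, neg_sub]

theorem reduces_eulerSum_pair (hz : ∀ s, 2 ≤ s → Reduces wt v s (zetaVal s))
    (hl : ∀ p q, 1 ≤ p → 2 ≤ q → Reduces wt v (p + q) (eulerSum [p] q)) {q p r : ℕ}
    (hq : 2 ≤ q) (hp : 2 ≤ p) (hr : 2 ≤ r) (heven : Even (q + p + r)) :
    Reduces wt v (q + p + r) (eulerSum [p, r] q) := by
  have hs := summable_int_nat_nat hq hp hr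
  set T := ∑' x : ℤ × (ℕ × ℕ), (x.1 : ℝ)⁻¹ ^ q * ((x.1 : ℝ) - ((x.2.1 : ℝ) + 1))⁻¹ ^ p *
      ((x.1 : ℝ) - ((x.2.2 : ℝ) + 1))⁻¹ ^ r
  have hred : Reduces wt v (q + p + r) T := by
    have h1 := (Equiv.prodComm (ℕ × ℕ) ℤ).hasSum_iff.2 hs.hasSum
    have h2 : HasSum (fun x : ℕ × ℕ => ∑' n : ℤ, (n : ℝ)⁻¹ ^ q *
        ((n : ℝ) - ((x.1 : ℝ) + 1))⁻¹ ^ p * ((n : ℝ) - ((x.2 : ℝ) + 1))⁻¹ ^ r) T :=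
      h1.prod_fiberwise fun k => (h1.summable.prod_factor k).hasSum
    -- On the diagonal `k = l` two poles merge, leaving the two-pole sum with exponent `p + r`.
    have h3 := sumReduces_tsum_int hz hq (show 2 ≤ p + r by omega)
    simp only [pow_add, ← mul_assoc] at h3
    have h4 := sumReduces_tsum_int_offDiagonal hz hl hq hp hr
    rw [h2.unique ((hasSum_offDiagonal_iff h3.1.hasSum).1 h4.1.hasSum)]
    exact (h3.2.congr_weight (by omega)).add h4.2
  have h2 : HasSum (fun n : ℤ => ∑' x : ℕ × ℕ, (n : ℝ)⁻¹ ^ q *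
      ((n : ℝ) - ((x.1 : ℝ) + 1))⁻¹ ^ p * ((n : ℝ) - ((x.2 : ℝ) + 1))⁻¹ ^ r) T :=
    hs.hasSum.prod_fiberwise fun n => (hs.prod_factor n).hasSum
  have hprod : ∀ (n : ℤ) {A B : ℝ}, n ≠ 0 →
      HasSum (fun k : ℕ => ((n : ℝ) - ((k : ℝ) + 1))⁻¹ ^ p) A →
      HasSum (fun k : ℕ => ((n : ℝ) - ((k : ℝ) + 1))⁻¹ ^ r) B →
      ∑' x : ℕ × ℕ, (n : ℝ)⁻¹ ^ q * ((n : ℝ) - ((x.1 : ℝ) + 1))⁻¹ ^ p *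
        ((n : ℝ) - ((x.2 : ℝ) + 1))⁻¹ ^ r = (n : ℝ)⁻¹ ^ q * (A * B) := by
    intro n A B hn hA hB
    have h := (hasSum_mul_prod hA hB).mul_left ((n : ℝ)⁻¹ ^ q)
    rw [← h.tsum_eq]
    simp only [mul_assoc]
  have hsign : (-1 : ℝ) ^ q * (-1) ^ p * (-1) ^ r = 1 := by
    rw [← pow_add, ← pow_add, heven.neg_one_pow]
  have hS := hasSum_eulerSum_pair (a := p) (b := r) (q := q) (by omega) (by omega) hq
  have hSp := hasSum_eulerSum_single (p := p) (q := q) (by omega) hq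
  have hSr := hasSum_eulerSum_single (p := r) (q := q) (by omega) hq
  have hSpr := hasSum_eulerSum_single (p := p) (q := q + r) (by omega) (by omega)
  have hSrp := hasSum_eulerSum_single (p := r) (q := q + p) (by omega) (by omega)
  have hZ := hasSum_zetaVal hq
  have hZp := hasSum_zetaVal (s := q + p) (by omega)
  have hZr := hasSum_zetaVal (s := q + r) (by omega)
  have hZpr := hasSum_zetaVal (s := q + p + r) (by omega)
  -- For `n > 0` the harmonic numbers stop at `n - 1`; rewriting them through `H_n` produces the
  -- corrections `S_{p,q+r}`, `S_{r,q+p}` and `ζ(q+p+r)`.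
  have hpos := ((((hS.sub hSpr).sub hSrp).add hZpr).add
    ((hSr.sub hZr).mul_left ((-1) ^ p * zetaVal p))).add
    (((hSp.sub hZp).mul_left ((-1) ^ r * zetaVal r)).add
      (hZ.mul_left ((-1) ^ p * zetaVal p * ((-1) ^ r * zetaVal r))))
  have hneg := ((hZ.mul_left (zetaVal p * zetaVal r)).sub (hSr.mul_left (zetaVal p))).sub
    (hSp.mul_left (zetaVal r)) |>.add hS
  have h3 := h2.unique (hasSum_int_of_nat (by simp [show q ≠ 0 by omega])
    (hpos.congr_fun fun k => by
      rw [hprod _ (by omega) (by simpa using hasSum_inv_sub_pow hp k)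
        (by simpa using hasSum_inv_sub_pow hr k), genHarmonic_succ, genHarmonic_succ]
      simp only [pow_add]
      push_cast
      ring)
    (hneg.congr_fun fun k => by
      rw [hprod _ (by omega) (by simpa using hasSum_inv_neg_sub_pow hp k)
        (by simpa using hasSum_inv_neg_sub_pow hr k)]
      push_cast
      rw [← neg_one_mul ((k : ℝ) + 1), mul_inv, mul_pow]
      linear_combination (((k : ℝ) + 1)⁻¹ ^ q * (zetaVal p - genHarmonic (k + 1) p) *
        (zetaVal r - genHarmonic (k + 1) r)) * hsign))
  have h5 : eulerSum [p, r] q = ((1 / 2 : ℚ) : ℝ) * (T + eulerSum [p] (q + r) +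
      eulerSum [r] (q + p) - zetaVal (q + p + r)
      - (-1) ^ p * (zetaVal p * (eulerSum [r] q - zetaVal (q + r)))
      - (-1) ^ r * (zetaVal r * (eulerSum [p] q - zetaVal (q + p)))
      - (((-1) ^ p * (-1) ^ r + 1 : ℚ) : ℝ) * (zetaVal p * zetaVal r * zetaVal q)
      + zetaVal p * eulerSum [r] q + zetaVal r * eulerSum [p] q) := by
    push_cast
    linear_combination (-1 / 2) * h3
  rw [h5]
  refine Reduces.rat_mul _ (.add (.add (.sub (.sub (.sub (.sub (.add (.add hred ?_) ?_) ?_) ?_) ?_)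
    ?_) ?_) ?_)
  · exact (hl p (q + r) (by omega) (by omega)).congr_weight (by omega)
  · exact (hl r (q + p) (by omega) (by omega)).congr_weight (by omega)
  · exact hz _ (by omega)
  · exact (((hz p hp).mul (((hl r q (by omega) hq).congr_weight (add_comm _ _)).sub
      (hz (q + r) (by omega)))).neg_one_pow_mul p).congr_weight (by omega)
  · exact (((hz r hr).mul (((hl p q (by omega) hq).congr_weight (add_comm _ _)).sub
      (hz (q + p) (by omega)))).neg_one_pow_mul r).congr_weight (by omega)
  · exact ((((hz p hp).mul (hz r hr)).mul (hz q hq)).rat_mul _).congr_weight (by omega)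
  · exact ((hz p hp).mul (hl r q (by omega) hq)).congr_weight (by omega)
  · exact ((hz r hr).mul (hl p q (by omega) hq)).congr_weight (by omega)

theorem reduces_eulerSum_one_one_sub (hz : ∀ s, 2 ≤ s → Reduces wt v s (zetaVal s)) {q : ℕ}
    (hq : 2 ≤ q) : Reduces wt v (q + 2) (eulerSum [1, 1] q - eulerSum [2] q) := by
  have h : eulerSum [1, 1] q - eulerSum [2] q =
      ((((q + 1) * (q + 3) / 3 : ℚ)) : ℝ) * zetaVal (q + 2) + zetaVal 2 * zetaVal q
      - (((q + 2) / 2 : ℚ) : ℝ) *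
          ∑ j ∈ Finset.Icc 0 (q - 2), zetaVal (j + 2) * zetaVal (q - j)
      + ((1 / 3 : ℚ) : ℝ) * ∑ j ∈ Finset.Icc 2 (q - 2), zetaVal (q - j) *
          ∑ i ∈ Finset.Icc 0 (j - 2), zetaVal (i + 2) * zetaVal (j - i) := by
    rw [eulerSum_one_one_eq hq]
    push_cast
    ring
  rw [h]
  refine .add (.sub (.add ((hz _ (by omega)).rat_mul _)
    (((hz 2 le_rfl).mul (hz q hq)).congr_weight (by omega)))
    (.rat_mul _ (.sum fun j hj => ?_))) (.rat_mul _ (.sum fun j hj => ?_))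
  · simp only [Finset.mem_Icc] at hj
    exact ((hz (j + 2) (by omega)).mul (hz (q - j) (by omega))).congr_weight (by omega)
  · simp only [Finset.mem_Icc] at hj
    refine ((hz (q - j) (by omega)).mul (.sum (w := j + 2) fun i hi => ?_)).congr_weight (by omega)
    simp only [Finset.mem_Icc] at hi
    exact ((hz (i + 2) (by omega)).mul (hz (j - i) (by omega))).congr_weight (by omega)

end

/-! ### The two concrete systems of generators -/

theorem reducesToZeta_zetaVal {s : ℕ} (hs : 2 ≤ s) : ReducesToZeta s (zetaVal s) :=
  Reduces.var (wt := fun s : ZetaIndex => s.1) (v := fun s : ZetaIndex => zetaVal s.1) ⟨s, hs⟩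

theorem reducesToLinearAndZeta_zetaVal {s : ℕ} (hs : 2 ≤ s) :
    ReducesToLinearAndZeta s (zetaVal s) :=
  Reduces.var (wt := Sum.elim (fun s : ZetaIndex => s.1) (fun a : LinearIndex => a.1.1 + a.1.2))
    (v := Sum.elim (fun s : ZetaIndex => zetaVal s.1)
      (fun a : LinearIndex => eulerSum [a.1.1] a.1.2)) (Sum.inl ⟨s, hs⟩)

theorem reducesToLinearAndZeta_eulerSum {p q : ℕ} (hp : 1 ≤ p) (hq : 2 ≤ q) :
    ReducesToLinearAndZeta (p + q) (eulerSum [p] q) :=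
  Reduces.var (wt := Sum.elim (fun s : ZetaIndex => s.1) (fun a : LinearIndex => a.1.1 + a.1.2))
    (v := Sum.elim (fun s : ZetaIndex => zetaVal s.1)
      (fun a : LinearIndex => eulerSum [a.1.1] a.1.2)) (Sum.inr ⟨(p, q), hp, hq⟩)

end

theorem mainTheorem10 :
    (∀ i₁ i₂ q : ℕ, 1 ≤ i₁ → 1 ≤ i₂ → 2 ≤ q →
      Summable (fun n : ℕ => eulerTerm [i₁, i₂] q (n + 1)) ∧
      (∀ s ∈ [[q, i₁ + i₂], [q, i₁, i₂], [q, i₂, i₁],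
          [q + i₁ + i₂], [q + i₁, i₂], [q + i₂, i₁]], Summable (mzvTerm s)) ∧
      eulerSum [i₁, i₂] q =
        mzv [q, i₁ + i₂] + mzv [q, i₁, i₂] + mzv [q, i₂, i₁]
          + mzv [q + i₁ + i₂] + mzv [q + i₁, i₂] + mzv [q + i₂, i₁]) ∧
    (∀ i₁ i₂ q : ℕ, 1 < i₁ → 1 < i₂ → 2 ≤ q → Even (i₁ + i₂ + q) →
      ReducesToLinearAndZeta (i₁ + i₂ + q) (eulerSum [i₁, i₂] q)) ∧
    (∀ q : ℕ, 2 ≤ q →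
      Summable (fun n : ℕ => eulerTerm [2] q (n + 1)) ∧
      eulerSum [1, 1] q =
        eulerSum [2] q + ((q : ℝ) + 1) * ((q : ℝ) + 3) / 3 * zetaVal (q + 2)
          + zetaVal 2 * zetaVal q
          - ((q : ℝ) + 2) / 2 *
              ∑ j ∈ Finset.Icc 0 (q - 2), zetaVal (j + 2) * zetaVal (q - j)
          + 1 / 3 * ∑ j ∈ Finset.Icc 2 (q - 2), zetaVal (q - j) *
              ∑ i ∈ Finset.Icc 0 (j - 2), zetaVal (i + 2) * zetaVal (j - i)) ∧
    (∀ q : ℕ, 2 ≤ q →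
      ∃ x : ℝ, ReducesToZeta (q + 2) x ∧ eulerSum [1, 1] q = eulerSum [2] q + x) ∧
    (∀ q : ℕ, 3 ≤ q → Odd q → ReducesToZeta (q + 2) (eulerSum [1, 1] q)) := by
  refine ⟨fun i₁ i₂ q h₁ h₂ hq => ⟨?_, ?_, eulerSum_pair_eq_mzv h₁ h₂ hq⟩, ?_,
    fun q hq => ⟨?_, eulerSum_one_one_eq hq⟩, fun q hq => ⟨eulerSum [1, 1] q - eulerSum [2] q,
      reduces_eulerSum_one_one_sub (fun _ => reducesToZeta_zetaVal) hq, by ring⟩, ?_⟩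
  · simpa only [eulerTerm_pair] using summable_genHarmonic_mul_genHarmonic h₁ h₂ hq
  · simp only [List.forall_mem_cons, List.not_mem_nil, false_imp_iff, implies_true, and_true]
    exact ⟨(mzv_pair_spec hq (by omega)).1, (mzv_triple_spec hq h₁ h₂).1,
      (mzv_triple_spec hq h₂ h₁).1, (mzv_single_spec (by omega)).1,
      (mzv_pair_spec (by omega) h₂).1, (mzv_pair_spec (by omega) h₁).1⟩
  · intro i₁ i₂ q h₁ h₂ hq heven
    exact Reduces.congr_weight (reduces_eulerSum_pair (fun _ => reducesToLinearAndZeta_zetaVal)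
      (fun _ _ => reducesToLinearAndZeta_eulerSum) hq h₁ h₂
      (by rwa [show q + i₁ + i₂ = i₁ + i₂ + q by omega])) (by omega)
  · simpa only [eulerTerm_single] using summable_genHarmonic (by norm_num) hq
  · intro q hq hodd
    have h₁ := reduces_eulerSum_one_one_sub (fun _ => reducesToZeta_zetaVal)
      (show 2 ≤ q by omega)
    -- For odd `q` the sum `S_{2,q}` has odd weight, so it reduces to zeta values.
    have h₂ := reduces_eulerSum_single (fun _ => reducesToZeta_zetaVal) (p := 2) (q := q) le_rfl
      (by omega) (hodd.add_even even_two)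
    have h₃ := h₁.add h₂
    rw [sub_add_cancel] at h₃
    exact h₃
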